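/- Let $I=[0,1]$, and let $\mathbb T^D=\mathbb R^D/\mathbb Z^D$ carry its flat (Euclidean) metric $d$ and its Lebesgue probability measure $\mathrm{Leb}$; $\mathbb T^D\times I$ carries the Euclidean product metric. A quasiperiodically forced interval map is a map $T(\theta,x)=(\omega(\theta),T_\theta(x))$ of $\mathbb T^D\times I$ into itself, where $\omega(\theta)=\theta+\rho \bmod 1$ with $\rho\in\mathbb R^D\setminus\mathbb Q^D$ and $T_\theta:I\to I$. Let $\mathcal T$ be the class of those $T$ for which all fibre maps $T_\theta$ are (weakly) monotonically increasing and differentiable, $(\theta,x)\mapsto T_\theta'(x)$ is continuous on $\mathbb T^D\times I$, $T_\theta(0)=0$ for all $\theta$, and $T$ is pinched, i.e. $\#T_{\theta_*}(I)=1$ for some $\theta_*\in\mathbb T^D$. Let $\mathcal T^*$ be the class of all $T\in\mathcal T$ for which there exist a point $\theta_*$ with $\#T_{\theta_*}(I)=1$ and constants $\alpha>2$, $\gamma>0$, $L_0\in(0,1)$, $\beta>0$, $c>0$, $d_0>1$, $m\in\mathbb N$, $a>1$, $b\in(0,1)$ such that, with $\tau_n=\omega^n(\theta_*)$: 1. $|T_\theta(x)-T_\theta(y)|\le\alpha|x-y|$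 for all $\theta$ and all $x,y\in[0,1]$; 2. $|T_\theta(x)-T_\theta(y)|\le\alpha^{-\gamma}|x-y|$ for all $\theta$ and all $x,y\in[L_0,1]$; 3. $|T_\theta(x)-T_{\theta'}(x)|\le\beta\, d(\theta,\theta')$ for all $\theta,\theta'$ and all $x\in[0,1]$; 4. $d(\tau_n,\theta_*)\ge c\,n^{-d_0}$ for all $n\ge1$ (Diophantine condition); 5. $m>22(1+1/\gamma)$, $a\ge(m+1)^{d_0}$, $b\le c$, and $d(\tau_n,\theta_*)>b$ for $n=1,\dots,m-1$; 6. $T_\theta(x)\ge\min\{L_0,ax\}\cdot\min\{1,\tfrac2b d(\theta,\theta_*)\}$ for all $(\theta,x)\in\mathbb T^D\times[0,1]$. For $T\in\mathcal T^*$ let $\mathcal A=\bigcap_{n}T^n(\mathbb T^D\times I)$, $\varphi^+(\theta)=\sup\{x\in I:(\theta,x)\in\mathcal A\}$, $\Phi^+=\{(\theta,\varphi^+(\theta)):\theta\in\mathbb T^D\}$, and let $\mu_{\varphi^+}(A)=\mathrm{Leb}(\pi_1(A\cap\Phi^+))$ for Borel sets $A\subseteq\mathbb T^D\times I$, where $\pi_1$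 is the projection to $\mathbb T^D$. **Theorem.** For every $T\in\mathcal T^*$ the measure $\mu=\mu_{\varphi^+}$ is $D$-rectifiable: $\mu=\Theta\,\mathcal H^D|_A$ for some Borel set $A$ and some Borel function $\Theta\ge0$, where $A$ is countably $D$-rectifiable, i.e. there are Lipschitz maps $g_i:A_i\to\mathbb T^D\times I$, $A_i\subseteq\mathbb R^D$, $i\in\mathbb N$, with $\mathcal H^D(A\setminus\bigcup_i g_i(A_i))=0$. Moreover $\mu$ is exact dimensional with pointwise dimension $D$, i.e. for $\mu$-almost every $p$ $$\liminf_{\varepsilon\to0}\frac{\log\mu(B_\varepsilon(p))}{\log\varepsilon}=\limsup_{\varepsilon\to0}\frac{\log\mu(B_\varepsilon(p))}{\log\varepsilon}=D,$$ and its information dimension exists and equals $D$: $$\liminf_{\varepsilon\to0}\frac{\int\log\mu(B_\varepsilon(p))\,d\mu(p)}{\log\varepsilon}=\limsup_{\varepsilon\to0}\frac{\int\log\mu(B_\varepsilon(p))\,d\mu(p)}{\log\varepsilon}=D.$$ -/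

import Mathlib

open MeasureTheory Set Filter Topology
open scoped unitInterval NNReal ENNReal

noncomputable section

namespace PinchedSkew

/-! ## Dimensions of measures and rectifiability in a metric space -/

section General

variable {X : Type*} [MetricSpace X] [MeasurableSpace X]

/-- Lower pointwise dimension of `μ` at `x`, in the extended reals (meaningful for `x` in the
support of `μ`, where all the balls have positive mass; the complement of the support is null in
a separable space). -/
def lowerPointwiseDim (μ : Measure X) (x : X) : EReal :=
  liminf (fun ε : ℝ => ((Real.log (μ.real (Metric.ball x ε)) / Real.log ε : ℝ) : EReal)) (𝓝[>] 0)

/-- Upper pointwise dimension of `μ` at `x`. -/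
def upperPointwiseDim (μ : Measure X) (x : X) : EReal :=
  limsup (fun ε : ℝ => ((Real.log (μ.real (Metric.ball x ε)) / Real.log ε : ℝ) : EReal)) (𝓝[>] 0)

/-- `μ` is exact dimensional with (almost everywhere constant) pointwise dimension `s`. -/
def IsExactDimensionalWith (μ : Measure X) (s : EReal) : Prop :=
  ∀ᵐ x ∂μ, lowerPointwiseDim μ x = s ∧ upperPointwiseDim μ x = s

/-- Lower information dimension. -/
def lowerInformationDim (μ : Measure X) : EReal :=
  liminf (fun ε : ℝ =>
    (((∫ x, Real.log (μ.real (Metric.ball x ε)) ∂μ) / Real.log ε : ℝ) : EReal)) (𝓝[>] 0)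

/-- Upper information dimension. -/
def upperInformationDim (μ : Measure X) : EReal :=
  limsup (fun ε : ℝ =>
    (((∫ x, Real.log (μ.real (Metric.ball x ε)) ∂μ) / Real.log ε : ℝ) : EReal)) (𝓝[>] 0)

/-- The information dimension of `μ` exists and equals `s`. The first clause makes sure that the
integrals in the definition are genuine (finite) integrals. -/
def HasInformationDim (μ : Measure X) (s : EReal) : Prop :=
  (∀ ε : ℝ, 0 < ε → Integrable (fun x => Real.log (μ.real (Metric.ball x ε))) μ) ∧
    lowerInformationDim μ = s ∧ upperInformationDim μ = s

/-- A Borel set `A` is countably `D`-rectifiable if `ℋ^D`-almost all of it is covered by countably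
many Lipschitz images of subsets of `ℝ^D`. -/
def CountablyRectifiable [BorelSpace X] (D : ℕ) (A : Set X) : Prop :=
  MeasurableSet A ∧
    ∃ (S : ℕ → Set (EuclideanSpace ℝ (Fin D))) (g : ℕ → EuclideanSpace ℝ (Fin D) → X),
      (∀ i, ∃ K : ℝ≥0, LipschitzOnWith K (g i) (S i)) ∧
        Measure.hausdorffMeasure (D : ℝ) (A \ ⋃ i, g i '' S i) = 0

/-- A finite Borel measure `μ` is `D`-rectifiable if `μ = Θ ℋ^D|_A` for a countably
`D`-rectifiable set `A` and a Borel density `Θ` with values in `[0, ∞)`. -/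
def RectifiableMeasure [BorelSpace X] (D : ℕ) (μ : Measure X) : Prop :=
  IsFiniteMeasure μ ∧
    ∃ (A : Set X) (Θ : X → ℝ≥0), CountablyRectifiable D A ∧ Measurable Θ ∧
      μ = ((Measure.hausdorffMeasure (D : ℝ)).restrict A).withDensity (fun x => (Θ x : ℝ≥0∞))

end General

/-! ## The torus and the phase space -/

/-- The torus `𝕋^D = ℝ^D / ℤ^D` with its flat (Euclidean) metric. -/
abbrev Torus (D : ℕ) : Type := PiLp 2 (fun _ : Fin D => UnitAddCircle)

/-- Lebesgue (probability) measure on the torus. -/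
def lebTorus (D : ℕ) : Measure (Torus D) :=
  Measure.map (WithLp.toLp 2) (volume : Measure (Fin D → UnitAddCircle))

/-- The phase space `𝕋^D × [0,1]` with the Euclidean product metric. -/
abbrev Phase (D : ℕ) : Type := WithLp 2 (Torus D × I)

/-- The point `(θ, x)` of the phase space. -/
abbrev pt {D : ℕ} (θ : Torus D) (x : I) : Phase D := WithLp.toLp 2 (θ, x)

/-! ## Quasiperiodically forced interval maps -/

/-- The data of a quasiperiodically forced interval map `(θ, x) ↦ (θ + ρ mod 1, T_θ(x))` on
`𝕋^D × [0,1]`; the rotation is irrational in the weakest sense, `ρ ∉ ℚ^D`. -/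
structure ForcedMap (D : ℕ) where
  /-- the rotation vector `ρ` -/
  rho : Fin D → ℝ
  irrational : ∃ i, Irrational (rho i)
  /-- the fibre maps `T_θ` -/
  fiber : Torus D → I → I

namespace ForcedMap

variable {D : ℕ} (T : ForcedMap D)

/-- The rotation vector modulo `ℤ^D`. -/
def rot : Torus D := WithLp.toLp 2 (fun i => (T.rho i : UnitAddCircle))

/-- The rotation `ω(θ) = θ + ρ mod 1`. -/
def base (θ : Torus D) : Torus D := θ + T.rot

/-- The skew product itself. -/
def map (p : Phase D) : Phase D := pt (T.base p.fst) (T.fiber p.fst p.snd)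

/-- `θ` is a pinching point: the fibre map `T_θ` has a one-point image. -/
def IsPinchingPoint (θ : Torus D) : Prop := (range (T.fiber θ)).encard = 1

/-- The class `𝒯`. -/
structure IsClassT : Prop where
  /-- the fibre maps are monotonically increasing -/
  mono : ∀ θ, Monotone (T.fiber θ)
  /-- the fibre maps are differentiable on `[0,1]`, with derivative continuous in `(θ, x)` -/
  diff : ∃ T' : Torus D → I → ℝ, Continuous (Function.uncurry T') ∧
    ∀ θ (x : I), HasDerivWithinAt (IccExtend zero_le_one (fun y : I => (T.fiber θ y : ℝ)))
      (T' θ x) (Icc 0 1) (x : ℝ)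
  /-- `T` is pinched -/
  pinched : ∃ θs, T.IsPinchingPoint θs
  /-- the zero line is invariant -/
  zero : ∀ θ, T.fiber θ 0 = 0

/-- The `C¹`-type estimates, with all their constants explicit; `θs` is the pinching point, and
`τ_n = ω^n(θs)`. -/
structure Estimates (θs : Torus D) (α γ L₀ β c d : ℝ) (m : ℕ) (a b : ℝ) : Prop where
  two_lt_alpha : 2 < α
  gamma_pos : 0 < γ
  L_mem : L₀ ∈ Ioo (0 : ℝ) 1
  beta_pos : 0 < β
  c_pos : 0 < c
  one_lt_d : 1 < d
  one_lt_a : 1 < a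
  b_mem : b ∈ Ioo (0 : ℝ) 1
  lipschitz_fiber : ∀ θ (x y : I),
    |(T.fiber θ x : ℝ) - T.fiber θ y| ≤ α * |(x : ℝ) - y|
  contraction_fiber : ∀ θ (x y : I), L₀ ≤ x → L₀ ≤ y →
    |(T.fiber θ x : ℝ) - T.fiber θ y| ≤ α ^ (-γ) * |(x : ℝ) - y|
  lipschitz_base : ∀ θ θ' (x : I),
    |(T.fiber θ x : ℝ) - T.fiber θ' x| ≤ β * dist θ θ'
  diophantine : ∀ n : ℕ, 1 ≤ n → c * (n : ℝ) ^ (-d) ≤ dist (T.base^[n] θs) θs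
  m_large : 22 * (1 + 1 / γ) < (m : ℝ)
  a_large : ((m : ℝ) + 1) ^ d ≤ a
  b_le_c : b ≤ c
  first_iterates : ∀ n : ℕ, 1 ≤ n → n < m → b < dist (T.base^[n] θs) θs
  reference : ∀ θ (x : I),
    min L₀ (a * x) * min 1 (2 / b * dist θ θs) ≤ T.fiber θ x

/-- The class `𝒯*`: the elements of `𝒯` which satisfy the estimates for some choice of the
pinching point and of the constants. -/
def IsClassTStar : Prop :=
  T.IsClassT ∧ ∃ θs, T.IsPinchingPoint θs ∧
    ∃ (α γ L₀ β c d : ℝ) (m : ℕ) (a b : ℝ), T.Estimates θs α γ L₀ β c d m a b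

/-- The global attractor `⋂ₙ Tⁿ(𝕋^D × [0,1])`. -/
def attractor : Set (Phase D) := ⋂ n : ℕ, range (T.map^[n])

/-- The upper bounding graph `φ⁺(θ) = sup {x | (θ, x) ∈ attractor}`. -/
def upperGraph (θ : Torus D) : I := sSup {x : I | pt θ x ∈ T.attractor}

/-- The point set `Φ⁺ = {(θ, φ⁺(θ))}`. -/
def upperGraphSet : Set (Phase D) := range (fun θ => pt θ (T.upperGraph θ))

/-- The physical measure `μ_{φ⁺}`: Lebesgue measure on the base, lifted to the graph `Φ⁺`. -/
def physicalMeasure : Measure (Phase D) :=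
  Measure.map (fun θ => pt θ (T.upperGraph θ)) (lebTorus D)

/-- An element of `𝒯*` is continuous. -/
theorem IsClassTStar.continuous_map {T : ForcedMap D} (hT : T.IsClassTStar) :
    Continuous T.map := by
  obtain ⟨-, θs, -, α, γ, L₀, β, c, d, m, a, b, h⟩ := hT
  have hf : Continuous (fun p : Torus D × I => T.fiber p.1 p.2) := by
    rw [continuous_induced_rng, continuous_iff_continuousAt]
    rintro ⟨θ, x⟩
    rw [ContinuousAt, tendsto_iff_dist_tendsto_zero]
    have hb : ∀ p : Torus D × I,
        dist ((T.fiber p.1 p.2 : I) : ℝ) (T.fiber θ x) ≤ β * dist p.1 θ + α * dist p.2 x := by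
      rintro ⟨θ', x'⟩
      refine (dist_triangle _ ((T.fiber θ x' : I) : ℝ) _).trans (add_le_add ?_ ?_)
      · exact h.lipschitz_base θ' θ x'
      · exact h.lipschitz_fiber θ x' x
    refine squeeze_zero (fun _ => dist_nonneg) hb ?_
    have hc : Continuous (fun p : Torus D × I => β * dist p.1 θ + α * dist p.2 x) := by
      fun_prop
    have := hc.tendsto (θ, x)
    simpa using this
  have hfst : Continuous (fun p : Phase D => p.fst) :=
    continuous_fst.comp (WithLp.prod_continuous_ofLp 2 _ _)
  have hsnd : Continuous (fun p : Phase D => p.snd) :=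
    continuous_snd.comp (WithLp.prod_continuous_ofLp 2 _ _)
  refine (WithLp.prod_continuous_toLp 2 _ _).comp (Continuous.prodMk ?_ ?_)
  · exact hfst.add continuous_const
  · exact hf.comp (hfst.prodMk hsnd)

theorem IsClassTStar.isCompact_attractor {T : ForcedMap D} (hT : T.IsClassTStar) :
    IsCompact T.attractor := by
  have : CompactSpace (Torus D) :=
    (PiLp.homeomorph 2 (fun _ : Fin D => UnitAddCircle)).symm.compactSpace
  have : CompactSpace (Phase D) :=
    (WithLp.homeomorphProd 2 (Torus D) I).symm.compactSpace
  refine IsClosed.isCompact (isClosed_iInter fun n => ?_)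
  exact (isCompact_range (hT.continuous_map.iterate n)).isClosed

/-- `φ⁺` is a measurable function, so that the push-forward that defines `μ_{φ⁺}` is genuine. -/
theorem IsClassTStar.measurable_upperGraph {T : ForcedMap D} (hT : T.IsClassTStar) :
    Measurable T.upperGraph := by
  have hpt : Continuous (fun q : Torus D × I => pt q.1 q.2) := WithLp.prod_continuous_toLp 2 _ _
  have hfst : Continuous (fun p : Phase D => p.fst) :=
    continuous_fst.comp (WithLp.prod_continuous_ofLp 2 _ _)
  have hsnd : Continuous (fun p : Phase D => p.snd) :=
    continuous_snd.comp (WithLp.prod_continuous_ofLp 2 _ _)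
  refine measurable_of_Ici fun t => ?_
  rcases eq_or_lt_of_le (unitInterval.nonneg' (t := t)) with h0 | h0
  · subst h0
    have : T.upperGraph ⁻¹' Ici 0 = univ := by
      ext θ
      simp
    rw [this]
    exact MeasurableSet.univ
  · have : T.upperGraph ⁻¹' Ici t =
        (fun p : Phase D => p.fst) '' (T.attractor ∩ {p | t ≤ p.snd}) := by
      ext θ
      constructor
      · intro h
        have hK : IsCompact {x : I | pt θ x ∈ T.attractor} :=
          (hT.isCompact_attractor.isClosed.preimage
            (hpt.comp (Continuous.prodMk_right θ))).isCompact
        have hne : {x : I | pt θ x ∈ T.attractor}.Nonempty := by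
          by_contra hne
          rw [not_nonempty_iff_eq_empty] at hne
          have h1 : t ≤ T.upperGraph θ := h
          rw [upperGraph, hne, sSup_empty] at h1
          exact absurd (h0.trans_le h1) (lt_irrefl _)
        exact ⟨pt θ (T.upperGraph θ), ⟨hK.sSup_mem hne, h⟩, rfl⟩
      · rintro ⟨p, ⟨hp, hpt'⟩, rfl⟩
        exact le_trans hpt' (le_sSup (s := {x : I | pt p.fst x ∈ T.attractor}) hp)
    rw [this]
    refine IsCompact.measurableSet (IsCompact.image ?_ hfst)
    exact hT.isCompact_attractor.inter_right (isClosed_le continuous_const hsnd)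

/-- `μ_{φ⁺}(A) = Leb(π₁(A ∩ Φ⁺))` for Borel sets `A`. -/
theorem IsClassTStar.physicalMeasure_apply {T : ForcedMap D} (hT : T.IsClassTStar)
    {A : Set (Phase D)} (hA : MeasurableSet A) :
    T.physicalMeasure A = lebTorus D ((fun p : Phase D => p.fst) '' (A ∩ T.upperGraphSet)) := by
  have hm : Measurable (fun θ => pt θ (T.upperGraph θ)) :=
    (WithLp.measurable_toLp 2 _).comp (measurable_id.prodMk hT.measurable_upperGraph)
  rw [physicalMeasure, Measure.map_apply hm hA]
  congr 1
  ext θ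
  constructor
  · exact fun h => ⟨_, ⟨h, θ, rfl⟩, rfl⟩
  · rintro ⟨p, ⟨hp, θ', rfl⟩, rfl⟩
    exact hp

end ForcedMap

end PinchedSkew

end

/-!
The measure `μ` is the lift of Lebesgue measure to the graph of `φ⁺`. The key fact is that, up to a
null set, the torus is a countable union of closed sets on each of which `φ⁺` is Lipschitz
(`IsClassTStar.exists_lipschitzOnWith_upperGraph`).

To see this, write `φ⁺` as the decreasing limit of the iterated boundary lines
`φ_n(θ) = T^n_{ω^{-n} θ}(1)`. Two values `φ_n(θ)` and `φ_n(θ')` are compared along the backward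
orbits of `θ` and `θ'`: each step adds an error `β d(θ, θ')`, and it contracts distances by
`α ^ (-γ)` if both orbits are above `L₀`, while it expands them by at most `α` otherwise. So a
uniform Lipschitz bound follows as soon as the orbits are below `L₀` for a small fraction of the
time. An orbit falls below `L₀` only by a visit close to the pinching point, and it then recovers by
a factor `a` in each step. Measured in powers of `a`, the loss is therefore bounded by a queue which
serves one unit per step and receives the work `s` from a visit at distance about
`(b / 2) a ^ (-s)` (`Estimates.exists_queue`). By the Diophantine condition, deep visits are rare:
those of depth more than `s` are at least `m 2 ^ s / 2` steps apart (`Estimates.return_time`).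
Off the balls of radius `(b / 2) a ^ (-(p + k) / m)` about `ω^k(θs)`, `k ≥ 1`, with a slightly
different normalisation of `p` (`slowSet`), the visit at time `-k` has depth at most of order
`(p + k) / m`. Hence the queue is busy for about `5 N / m` of the first `N` steps (`card_busy_le`),
and `m > 22 (1 + 1 / γ)` makes the contraction win. The radii are summable, so the remaining points
form a null set.

Rectifiability follows since a Lipschitz graph over the base carries a finite Hausdorff measure
with respect to which the lift of Lebesgue measure is absolutely continuous
(`rectifiableMeasure_graph`). For the pointwise dimension, the upper bound
`μ (ball p ε) ≤ (2 ε) ^ D` is immediate by projection, and Lebesgue density points of the good sets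
give the lower bound `c ε ^ D`. The information dimension is obtained by integrating the
pointwise limit; uniform integrability comes from
`∫ (μ (ball p ε))⁻¹ ∂μ ≤ #cover = O(ε ^ (-(D + 1)))` (`hasInformationDim_of_ae_tendsto`).
-/

noncomputable section

namespace PinchedSkew

/-! ### Geometry and measure of the torus and of the phase space -/

variable {D : ℕ}

instance : IsProbabilityMeasure (lebTorus D) := by
  have : IsProbabilityMeasure (volume : Measure UnitAddCircle) :=
    ⟨by rw [AddCircle.measure_univ, ENNReal.ofReal_one]⟩
  have : IsProbabilityMeasure (volume : Measure (Fin D → UnitAddCircle)) := by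
    rw [volume_pi]; infer_instance
  exact Measure.isProbabilityMeasure_map (WithLp.measurable_toLp 2 _).aemeasurable

/-- The covering projection `ℝ^D → 𝕋^D`, with the sup norm on `ℝ^D`. -/
def torusProj (x : Fin D → ℝ) : Torus D := WithLp.toLp 2 (fun i => (x i : UnitAddCircle))

theorem exists_lipschitzWith_torusProj : ∃ K : ℝ≥0, LipschitzWith K (torusProj (D := D)) := by
  have h : LipschitzWith 1 (fun (x : Fin D → ℝ) (i : Fin D) => (x i : UnitAddCircle)) := by
    refine LipschitzWith.of_dist_le_mul fun x y => ?_
    rw [NNReal.coe_one, one_mul, dist_pi_le_iff dist_nonneg]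
    intro i
    refine le_trans ?_ (dist_le_pi_dist x y i)
    rw [dist_eq_norm, dist_eq_norm, ← AddCircle.coe_sub]
    exact QuotientAddGroup.norm_mk_le_norm
  exact ⟨_, (PiLp.lipschitzWith_toLp 2 (fun _ : Fin D => UnitAddCircle)).comp h⟩

theorem exists_mem_Icc_torusProj_eq (θ : Torus D) :
    ∃ x ∈ Icc (0 : Fin D → ℝ) 1, torusProj x = θ := by
  have h : ∀ i, ∃ x ∈ Ico (0 : ℝ) (0 + 1), (x : UnitAddCircle) = θ i := fun i => by
    have := AddCircle.coe_image_Ico_eq (1 : ℝ) 0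
    have h2 : θ i ∈ (univ : Set UnitAddCircle) := mem_univ _
    rw [← this] at h2
    exact h2
  choose x hx hx' using h
  refine ⟨x, ⟨fun i => (hx i).1, fun i => ?_⟩, ?_⟩
  · simpa using (hx i).2.le
  · ext i
    exact hx' i

theorem lebTorus_closedBall_le (θ : Torus D) {r : ℝ} (hr : 0 ≤ r) :
    lebTorus D (Metric.closedBall θ r) ≤ ENNReal.ofReal (2 * r) ^ D := by
  rw [lebTorus, Measure.map_apply (WithLp.measurable_toLp 2 _)
    Metric.isClosed_closedBall.measurableSet]
  have hsub : WithLp.toLp 2 ⁻¹' Metric.closedBall θ r ⊆ Metric.closedBall (WithLp.ofLp θ) r := by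
    intro x hx
    have := (PiLp.lipschitzWith_ofLp 2 (fun _ : Fin D => UnitAddCircle)).dist_le_mul
      (WithLp.toLp 2 x) θ
    rw [NNReal.coe_one, one_mul] at this
    exact this.trans hx
  refine (measure_mono hsub).trans ?_
  rw [volume_pi_closedBall _ hr]
  refine (Finset.prod_le_pow_card _ _ (ENNReal.ofReal (2 * r)) fun i _ => ?_).trans (by simp)
  rw [AddCircle.volume_closedBall]
  exact ENNReal.ofReal_le_ofReal (min_le_right _ _)

theorem exists_le_lebTorus_closedBall : ∃ κ : ℝ, 0 < κ ∧ ∀ (θ : Torus D) (r : ℝ), 0 ≤ r →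
    r ≤ 1 / 2 → ENNReal.ofReal (κ * r) ^ D ≤ lebTorus D (Metric.closedBall θ r) := by
  obtain ⟨K, hK⟩ : ∃ K : ℝ≥0,
      LipschitzWith K (WithLp.toLp 2 : (Fin D → UnitAddCircle) → Torus D) :=
    ⟨_, PiLp.lipschitzWith_toLp 2 (fun _ : Fin D => UnitAddCircle)⟩
  have hK1 : (0 : ℝ) < K + 1 := by positivity
  refine ⟨2 / (K + 1), by positivity, fun θ r hr hr2 => ?_⟩
  rw [lebTorus, Measure.map_apply (WithLp.measurable_toLp 2 _)
    Metric.isClosed_closedBall.measurableSet]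
  have hsub : Metric.closedBall (WithLp.ofLp θ) (r / (K + 1)) ⊆
      WithLp.toLp 2 ⁻¹' Metric.closedBall θ r := by
    intro x hx
    have h1 := hK.dist_le_mul x (WithLp.ofLp θ)
    have h2 : dist x (WithLp.ofLp θ) ≤ r / (K + 1) := hx
    refine h1.trans ((mul_le_mul_of_nonneg_left h2 K.2).trans ?_)
    rw [mul_div_assoc', div_le_iff₀ hK1, mul_comm]
    exact mul_le_mul_of_nonneg_left (by simp) hr
  refine le_trans ?_ (measure_mono hsub)
  rw [volume_pi_closedBall _ (by positivity)]
  simp only [AddCircle.volume_closedBall, Finset.prod_const, Finset.card_univ, Fintype.card_fin]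
  have hle : r / (K + 1) ≤ 1 / 2 := by
    refine (div_le_self hr ?_).trans hr2
    simp
  rw [min_eq_right (by linarith)]
  exact le_of_eq (by congr 2; ring)

/-- A set of diameter `δ` lies in a closed ball of radius `δ`, so Lebesgue measure is at most
`2 ^ D` times Hausdorff measure. -/
theorem lebTorus_absolutelyContinuous :
    lebTorus D ≪ (Measure.hausdorffMeasure (D : ℝ) : Measure (Torus D)) := by
  have key : ((2 : ℝ≥0∞) ^ D)⁻¹ • lebTorus D ≤ Measure.hausdorffMeasure (D : ℝ) := by
    refine Measure.le_hausdorffMeasure _ _ 1 one_pos fun s hs => ?_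
    rcases s.eq_empty_or_nonempty with rfl | ⟨x, hx⟩
    · simp
    have hfin : Metric.ediam s ≠ ∞ := ne_top_of_le_ne_top ENNReal.one_ne_top hs
    have hsub : s ⊆ Metric.closedBall x (Metric.diam s) := fun y hy =>
      Metric.dist_le_diam_of_mem' hfin hy hx
    rw [Measure.smul_apply, smul_eq_mul, ENNReal.inv_mul_le_iff (by simp) (by simp)]
    refine (measure_mono hsub).trans ((lebTorus_closedBall_le x Metric.diam_nonneg).trans ?_)
    rw [ENNReal.ofReal_mul (by norm_num), mul_pow, ENNReal.rpow_natCast, Metric.diam,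
      ENNReal.ofReal_toReal hfin]
    simp
  refine (Measure.AbsolutelyContinuous.trans ?_ (Measure.absolutelyContinuous_of_le key))
  refine Measure.AbsolutelyContinuous.mk fun s _ hs => ?_
  simpa using hs

theorem hausdorffMeasure_torus_lt_top :
    Measure.hausdorffMeasure (D : ℝ) (univ : Set (Torus D)) < ∞ := by
  obtain ⟨K, hK⟩ := exists_lipschitzWith_torusProj (D := D)
  have huniv : (univ : Set (Torus D)) ⊆ torusProj '' Icc (0 : Fin D → ℝ) 1 := fun θ _ =>
    exists_mem_Icc_torusProj_eq θ
  refine (measure_mono huniv).trans_lt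
    ((hK.hausdorffMeasure_image_le (Nat.cast_nonneg D) _).trans_lt ?_)
  refine ENNReal.mul_lt_top (by simp) ?_
  have := hausdorffMeasure_pi_real (ι := Fin D)
  rw [Fintype.card_fin] at this
  rw [this]
  exact isCompact_Icc.measure_lt_top

instance : IsUnifLocDoublingMeasure (lebTorus D) := by
  obtain ⟨κ, hκ, h⟩ := exists_le_lebTorus_closedBall (D := D)
  refine ⟨⟨Real.toNNReal (4 / κ) ^ D, ?_⟩⟩
  filter_upwards [Ioo_mem_nhdsGT (show (0 : ℝ) < 1 / 2 by norm_num)] with ε hε θ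
  refine (lebTorus_closedBall_le θ (by linarith [hε.1])).trans ?_
  refine le_trans (le_of_eq ?_) (mul_le_mul_right (h θ ε hε.1.le hε.2.le) _)
  rw [ENNReal.coe_pow, ← mul_pow]
  change _ = (ENNReal.ofReal (4 / κ) * _) ^ D
  rw [← ENNReal.ofReal_mul (by positivity)]
  congr 2
  field_simp
  ring

theorem phase_dist_eq (p q : Phase D) :
    dist p q = √(dist p.fst q.fst ^ 2 + dist p.snd q.snd ^ 2) := by
  rw [WithLp.prod_dist_eq_add (by norm_num), Real.sqrt_eq_rpow]
  norm_num

theorem phase_dist_le (p q : Phase D) : dist p q ≤ dist p.fst q.fst + dist p.snd q.snd := by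
  rw [phase_dist_eq]
  refine (Real.sqrt_le_left (by positivity)).2 ?_
  nlinarith [mul_nonneg (dist_nonneg (x := p.fst) (y := q.fst))
    (dist_nonneg (x := p.snd) (y := q.snd))]

theorem dist_fst_le (p q : Phase D) : dist p.fst q.fst ≤ dist p q := by
  rw [phase_dist_eq]
  exact Real.le_sqrt_of_sq_le (by nlinarith [sq_nonneg (dist p.snd q.snd)])

/-- The phase space is covered by `O(ε ^ (-(D + 1)))` balls of radius `ε / 2`. -/
theorem exists_cover_phase : ∃ C : ℝ, ∀ ε : ℝ, 0 < ε → ε ≤ 1 → ∃ t : Finset (Phase D),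
    (t.card : ℝ) ≤ C * (ε ^ (D + 1))⁻¹ ∧ ∀ p, ∃ c ∈ t, dist p c < ε / 2 := by
  obtain ⟨K, hK⟩ := exists_lipschitzWith_torusProj (D := D)
  refine ⟨(2 * K + 5) ^ (D + 1), fun ε hε hε1 => ?_⟩
  -- a grid of mesh `1 / n` in the unit cube is mapped to a `(K + 1) / n`-dense set
  set n : ℕ := ⌊2 * (K + 1) / ε⌋₊ + 1 with hn
  have hn0 : (0 : ℝ) < n := by rw [hn]; positivity
  have hnlt : 2 * (K + 1) / ε < n := by rw [hn]; exact_mod_cast Nat.lt_floor_add_one _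
  have hnle : (n : ℝ) + 1 ≤ (2 * K + 5 - 1) / ε := by
    have h1 := Nat.floor_le (show 0 ≤ 2 * ((K : ℝ) + 1) / ε by positivity)
    have h2 : 1 ≤ 1 / ε := by rw [le_div_iff₀ hε]; linarith
    have h3 : (2 * (K : ℝ) + 5 - 1) / ε = 2 * (K + 1) / ε + 2 * (1 / ε) := by ring
    rw [hn, h3]; push_cast; linarith
  have hI : ∀ k : Fin (n + 1), (k : ℝ) / n ∈ I := fun k =>
    ⟨by positivity, by rw [div_le_one hn0]; exact_mod_cast Nat.lt_succ_iff.1 k.2⟩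
  let F : (Fin D → Fin (n + 1)) × Fin (n + 1) → Phase D := fun u =>
    pt (torusProj fun i => (u.1 i : ℝ) / n) ⟨(u.2 : ℝ) / n, hI u.2⟩
  have hround : ∀ x : ℝ, x ∈ Icc (0 : ℝ) 1 → ∃ k : Fin (n + 1), |x - (k : ℝ) / n| ≤ 1 / n := by
    intro x hx
    refine ⟨⟨⌊x * n⌋₊, ?_⟩, ?_⟩
    · have : ⌊x * n⌋₊ ≤ n := Nat.floor_le_of_le (mul_le_of_le_one_left hn0.le hx.2)
      omega
    · have h1 := Nat.floor_le (mul_nonneg hx.1 hn0.le)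
      have h2 := Nat.lt_floor_add_one (x * n)
      have h3 : x - (⌊x * n⌋₊ : ℝ) / n = (x * n - ⌊x * n⌋₊) / n := by field_simp
      simp only [h3]
      rw [abs_of_nonneg (div_nonneg (by linarith) hn0.le)]
      gcongr
      linarith
  refine ⟨Finset.univ.image F, ?_, fun p => ?_⟩
  · calc ((Finset.univ.image F).card : ℝ) ≤ ((n : ℝ) + 1) ^ (D + 1) := by
          have : (Finset.univ.image F).card ≤ (n + 1) ^ (D + 1) := by
            refine Finset.card_image_le.trans (le_of_eq ?_)
            simp [pow_succ]
          exact_mod_cast this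
      _ ≤ ((2 * K + 5) / ε) ^ (D + 1) := by
          gcongr
          refine hnle.trans ?_
          gcongr
          linarith
      _ = _ := by rw [div_pow, div_eq_mul_inv]
  · obtain ⟨x, hx, hxp⟩ := exists_mem_Icc_torusProj_eq p.fst
    choose k hk using fun i => hround (x i) ⟨hx.1 i, hx.2 i⟩
    obtain ⟨l, hl⟩ := hround p.snd p.snd.2
    refine ⟨F (k, l), Finset.mem_image_of_mem _ (Finset.mem_univ _), ?_⟩
    refine (phase_dist_le _ _).trans_lt ?_
    have h1 : dist p.fst (F (k, l)).fst ≤ K * (1 / n) := by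
      rw [← hxp]
      refine (hK.dist_le_mul _ _).trans (mul_le_mul_of_nonneg_left ?_ K.2)
      exact (dist_pi_le_iff (by positivity)).2 hk
    have h2 : dist p.snd (F (k, l)).snd ≤ 1 / n := hl
    have h3 : (K + 1) * (1 / n) < ε / 2 := by
      rw [div_lt_iff₀ hε] at hnlt
      rw [mul_one_div, div_lt_iff₀ hn0]
      linarith
    linarith

/-! ### Information dimension from pointwise dimension -/

theorem measurable_measure_ball {X : Type*} [MetricSpace X] [MeasurableSpace X] [BorelSpace X]
    [SecondCountableTopology X] (μ : Measure X) [SFinite μ] (ε : ℝ) :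
    Measurable fun x => μ (Metric.ball x ε) :=
  measurable_measure_prodMk_left (s := {z : X × X | dist z.2 z.1 < ε})
    (measurableSet_lt (measurable_snd.dist measurable_fst) measurable_const)

/-- If `p` lies in a ball `B` of radius `ε / 2`, then `B ⊆ ball p ε`; so each member of a cover by
such balls contributes at most `1` to the integral. -/
theorem lintegral_inv_measure_ball_le {X : Type*} [MetricSpace X] [MeasurableSpace X]
    [BorelSpace X] (μ : Measure X) {ε : ℝ} (t : Finset X)
    (ht : ∀ p, ∃ c ∈ t, dist p c < ε / 2) :
    ∫⁻ p, (μ (Metric.ball p ε))⁻¹ ∂μ ≤ t.card := by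
  have hcov : (⋃ c : t, Metric.ball (c : X) (ε / 2)) = univ := by
    refine eq_univ_of_forall fun p => ?_
    obtain ⟨c, hc, hd⟩ := ht p
    exact mem_iUnion.2 ⟨⟨c, hc⟩, hd⟩
  rw [← setLIntegral_univ, ← hcov]
  refine (lintegral_iUnion_le _ _).trans ?_
  rw [tsum_fintype]
  calc ∑ c : t, ∫⁻ p in Metric.ball (c : X) (ε / 2), (μ (Metric.ball p ε))⁻¹ ∂μ
      ≤ ∑ _c : t, (1 : ℝ≥0∞) := by
        refine Finset.sum_le_sum fun c _ => ?_
        refine (setLIntegral_mono' (g := fun _ => (μ (Metric.ball (c : X) (ε / 2)))⁻¹)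
          Metric.isOpen_ball.measurableSet fun p hp => ?_).trans ?_
        · refine ENNReal.inv_le_inv.2 (measure_mono fun y hy => ?_)
          rw [Metric.mem_ball] at hp hy ⊢
          have := dist_triangle_right y p (c : X)
          linarith
        · rw [setLIntegral_const]
          exact ENNReal.inv_mul_le_one _
    _ = t.card := by simp

theorem pointwiseDim_eq_of_tendsto {X : Type*} [MetricSpace X] [MeasurableSpace X]
    {μ : Measure X} {x : X} {s : ℝ}
    (h : Tendsto (fun ε : ℝ => Real.log (μ.real (Metric.ball x ε)) / Real.log ε)
      (𝓝[>] 0) (𝓝 s)) :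
    lowerPointwiseDim μ x = s ∧ upperPointwiseDim μ x = s := by
  have h' := (continuous_coe_real_ereal.tendsto s).comp h
  exact ⟨h'.liminf_eq, h'.limsup_eq⟩

/-- If `μ` has pointwise dimension `s` almost everywhere and the space is covered by
`O(ε ^ (-k))` balls of radius `ε / 2`, then the information dimension of `μ` is `s`. The covering
condition bounds `∫ (μ (ball p ε))⁻¹`, which makes the functions `log μ (ball p ε) / log ε`
uniformly integrable. -/
theorem hasInformationDim_of_ae_tendsto {X : Type*} [MetricSpace X] [MeasurableSpace X]
    [BorelSpace X] [SecondCountableTopology X] {μ : Measure X} [IsProbabilityMeasure μ]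
    {s C : ℝ} {k : ℕ}
    (hsk : s ≤ k + 1)
    (hcov : ∀ ε : ℝ, 0 < ε → ε ≤ 1 → ∃ t : Finset X,
      (t.card : ℝ) ≤ C * (ε ^ k)⁻¹ ∧ ∀ p, ∃ c ∈ t, dist p c < ε / 2)
    (hlim : ∀ᵐ x ∂μ, Tendsto (fun ε : ℝ => Real.log (μ.real (Metric.ball x ε)) / Real.log ε)
      (𝓝[>] 0) (𝓝 s)) :
    HasInformationDim μ s := by
  have hmeas : ∀ ε, Measurable fun x => μ.real (Metric.ball x ε) := fun ε =>
    (measurable_measure_ball μ ε).ennreal_toReal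
  have ht1 : ∀ x ε, μ.real (Metric.ball x ε) ≤ 1 := fun x ε => measureReal_le_one
  have hinv : ∀ ε : ℝ, 0 < ε → ε ≤ 1 →
      Integrable (fun x => (μ.real (Metric.ball x ε))⁻¹) μ ∧
        ∫ x, (μ.real (Metric.ball x ε))⁻¹ ∂μ ≤ C * (ε ^ k)⁻¹ := by
    intro ε hε hε1
    obtain ⟨t, htc, ht⟩ := hcov ε hε hε1
    have hb := lintegral_inv_measure_ball_le μ t ht
    have hm : Measurable fun x => (μ (Metric.ball x ε))⁻¹ := (measurable_measure_ball μ ε).inv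
    have hne : ∫⁻ p, (μ (Metric.ball p ε))⁻¹ ∂μ ≠ ∞ :=
      ne_top_of_le_ne_top (ENNReal.natCast_ne_top _) hb
    have heq : (fun x => (μ.real (Metric.ball x ε))⁻¹) =
        fun x => ((μ (Metric.ball x ε))⁻¹).toReal := by
      funext x
      rw [ENNReal.toReal_inv, Measure.real]
    rw [heq]
    refine ⟨integrable_toReal_of_lintegral_ne_top hm.aemeasurable hne, ?_⟩
    rw [integral_toReal hm.aemeasurable (ae_lt_top hm hne)]
    refine le_trans ?_ htc
    simpa using ENNReal.toReal_mono (ENNReal.natCast_ne_top _) hb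
  have hlogint : ∀ ε : ℝ, 0 < ε →
      Integrable (fun x => Real.log (μ.real (Metric.ball x ε))) μ := by
    intro ε hε
    -- shrinking the radius increases `|log μ (ball x ε)|` wherever the smaller ball is charged
    have hpos : ∀ᵐ x ∂μ, 0 < μ (Metric.ball x (min ε 1)) := by
      obtain ⟨t, -, ht⟩ := hcov (min ε 1) (lt_min hε one_pos) (min_le_right _ _)
      have hb := lintegral_inv_measure_ball_le μ t ht
      have hm := (measurable_measure_ball μ (min ε 1)).inv
      filter_upwards [ae_lt_top hm (ne_top_of_le_ne_top (ENNReal.natCast_ne_top _) hb)] with x hx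
      exact ENNReal.inv_lt_top.1 hx
    refine ((hinv (min ε 1) (lt_min hε one_pos) (min_le_right _ _)).1).mono'
      (hmeas ε).log.aestronglyMeasurable ?_
    filter_upwards [hpos] with x hx
    have hr : 0 < μ.real (Metric.ball x (min ε 1)) :=
      ENNReal.toReal_pos hx.ne' (measure_ne_top _ _)
    have hle : μ.real (Metric.ball x (min ε 1)) ≤ μ.real (Metric.ball x ε) :=
      measureReal_mono (Metric.ball_subset_ball (min_le_left _ _))
    rw [Real.norm_eq_abs, abs_of_nonpos (Real.log_nonpos measureReal_nonneg (ht1 _ _)),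
      ← Real.log_inv]
    refine (Real.log_le_self (by positivity)).trans ?_
    exact inv_anti₀ hr hle
  set F : ℝ → X → ℝ := fun ε x => Real.log (μ.real (Metric.ball x ε)) / Real.log ε with hF
  have hFmeas : ∀ ε, Measurable (F ε) := fun ε => (hmeas ε).log.div_const _
  have hFint : ∀ ε, 0 < ε → Integrable (F ε) μ := fun ε hε => (hlogint ε hε).div_const _
  have hε0 : ∀ᶠ ε : ℝ in 𝓝[>] 0, 0 < ε ∧ ε < Real.exp (-1) :=
    Ioo_mem_nhdsGT (Real.exp_pos _)
  have hlog : ∀ ε : ℝ, 0 < ε → ε < Real.exp (-1) → 1 ≤ -Real.log ε := fun ε h0 h1 => by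
    have := Real.log_lt_log h0 h1
    rw [Real.log_exp] at this
    linarith
  have hF0 : ∀ ε, 0 < ε → ε < Real.exp (-1) → ∀ x, 0 ≤ F ε x := fun ε h0 h1 x =>
    div_nonneg_of_nonpos (Real.log_nonpos measureReal_nonneg (ht1 _ _))
      (by linarith [hlog ε h0 h1])
  have hFle : ∀ ε, 0 < ε → ε < Real.exp (-1) → ∀ x,
      F ε x ≤ (k + 1) + ε ^ (k + 1) * (μ.real (Metric.ball x ε))⁻¹ := by
    intro ε h0 h1 x
    have hL := hlog ε h0 h1
    rw [hF]
    simp only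
    rw [← neg_div_neg_eq, div_le_iff₀ (by linarith)]
    have hnn : 0 ≤ ε ^ (k + 1) * (μ.real (Metric.ball x ε))⁻¹ := by positivity
    rcases eq_or_lt_of_le (measureReal_nonneg (μ := μ) (s := Metric.ball x ε)) with h | h
    · rw [← h]
      simp only [Real.log_zero, neg_zero, inv_zero, mul_zero, add_zero]
      positivity
    · have hlg := Real.log_le_self hnn
      rw [Real.log_mul (by positivity) (by positivity), Real.log_pow, Real.log_inv] at hlg
      push_cast at hlg
      nlinarith
  have hmin : Tendsto (fun ε => ∫ x, min (F ε x) (k + 1) ∂μ) (𝓝[>] 0) (𝓝 s) := by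
    have : ∫ _, s ∂μ = s := by simp
    rw [← this]
    refine tendsto_integral_filter_of_dominated_convergence (fun _ => (k : ℝ) + 1) ?_ ?_
      (integrable_const _) ?_
    · exact Eventually.of_forall fun ε => ((hFmeas ε).min measurable_const).aestronglyMeasurable
    · filter_upwards [hε0] with ε hε
      refine Eventually.of_forall fun x => ?_
      rw [Real.norm_eq_abs, abs_of_nonneg (le_min (hF0 ε hε.1 hε.2 x) (by positivity))]
      exact min_le_right _ _
    · filter_upwards [hlim] with x hx
      have := hx.min (tendsto_const_nhds (x := (k : ℝ) + 1))
      rwa [min_eq_left hsk] at this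
  have hint : Tendsto (fun ε => ∫ x, F ε x ∂μ) (𝓝[>] 0) (𝓝 s) := by
    have hup : Tendsto (fun ε => ∫ x, min (F ε x) (k + 1) ∂μ + C * ε) (𝓝[>] 0) (𝓝 s) := by
      have h0 : Tendsto (fun ε : ℝ => C * ε) (𝓝[>] 0) (𝓝 (C * 0)) :=
        (continuous_const_mul C).tendsto 0 |>.mono_left nhdsWithin_le_nhds
      simpa using hmin.add h0
    have he1 : Real.exp (-1) ≤ 1 := Real.exp_le_one_iff.2 (by norm_num)
    have hminint : ∀ ε, 0 < ε → Integrable (fun x => min (F ε x) (k + 1)) μ := fun ε hε =>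
      (hFint ε hε).inf (integrable_const _)
    refine tendsto_of_tendsto_of_tendsto_of_le_of_le' hmin hup ?_ ?_
    · filter_upwards [hε0] with ε hε
      exact integral_mono (hminint ε hε.1) (hFint ε hε.1) fun x => min_le_left _ _
    · filter_upwards [hε0] with ε hε
      obtain ⟨hi, hi'⟩ := hinv ε hε.1 (hε.2.le.trans he1)
      calc ∫ x, F ε x ∂μ
          ≤ ∫ x, (min (F ε x) (k + 1) + ε ^ (k + 1) * (μ.real (Metric.ball x ε))⁻¹) ∂μ := by
            refine integral_mono (hFint ε hε.1) ((hminint ε hε.1).add (hi.const_mul _)) fun x => ?_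
            have h1 := hFle ε hε.1 hε.2 x
            have h2 : 0 ≤ ε ^ (k + 1) * (μ.real (Metric.ball x ε))⁻¹ := by
              have := hε.1
              positivity
            simp only
            rcases le_total (F ε x) (k + 1) with h | h
            · rw [min_eq_left h]; linarith
            · rw [min_eq_right h]; linarith
        _ = ∫ x, min (F ε x) (k + 1) ∂μ +
              ε ^ (k + 1) * ∫ x, (μ.real (Metric.ball x ε))⁻¹ ∂μ := by
            rw [integral_add (hminint ε hε.1) (hi.const_mul _), integral_const_mul]
        _ ≤ _ := by
            have h0 := hε.1
            have h3 : ε ^ (k + 1) * ∫ x, (μ.real (Metric.ball x ε))⁻¹ ∂μ ≤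
                ε ^ (k + 1) * (C * (ε ^ k)⁻¹) := by gcongr
            have h4 : ε ^ (k + 1) * (C * (ε ^ k)⁻¹) = C * ε := by
              field_simp
              ring
            linarith
  have hfin : Tendsto (fun ε : ℝ =>
      (((∫ x, Real.log (μ.real (Metric.ball x ε)) ∂μ) / Real.log ε : ℝ) : EReal))
      (𝓝[>] 0) (𝓝 (s : EReal)) := by
    have := (continuous_coe_real_ereal.tendsto s).comp hint
    refine this.congr fun ε => ?_
    simp only [hF, Function.comp, integral_div]
  exact ⟨hlogint, hfin.liminf_eq, hfin.limsup_eq⟩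

theorem tendsto_log_div_log {f : ℝ → ℝ} {c C : ℝ} (hc : 0 < c) (n : ℕ)
    (hlow : ∀ᶠ ε in 𝓝[>] 0, c * ε ^ n ≤ f ε) (hup : ∀ᶠ ε in 𝓝[>] 0, f ε ≤ C * ε ^ n) :
    Tendsto (fun ε => Real.log (f ε) / Real.log ε) (𝓝[>] 0) (𝓝 (n : ℝ)) := by
  have hlim : ∀ C : ℝ, Tendsto (fun ε => (n : ℝ) + Real.log C / Real.log ε) (𝓝[>] 0)
      (𝓝 (n : ℝ)) := fun C => by
    simpa using (Real.tendsto_log_nhdsGT_zero.const_div_atBot (Real.log C)).const_add (n : ℝ)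
  have h01 : ∀ᶠ ε : ℝ in 𝓝[>] 0, ε ∈ Ioo (0 : ℝ) 1 := Ioo_mem_nhdsGT one_pos
  refine tendsto_of_tendsto_of_tendsto_of_le_of_le' (hlim C) (hlim c) ?_ ?_
  all_goals
    filter_upwards [hlow, hup, h01] with ε h1 h2 hε
    have hε0 := hε.1
    have hlog : Real.log ε < 0 := Real.log_neg hε0 hε.2
    have hf : 0 < f ε := lt_of_lt_of_le (by positivity) h1
    have hC : 0 < C := pos_of_mul_pos_left (hf.trans_le h2) (by positivity)
    have h3 : ∀ x : ℝ, 0 < x → (n : ℝ) + Real.log x / Real.log ε =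
        Real.log (x * ε ^ n) / Real.log ε := fun x hx => by
      rw [Real.log_mul hx.ne' (by positivity), Real.log_pow, add_div,
        mul_div_cancel_right₀ _ hlog.ne, add_comm]
  · rw [h3 C hC]
    exact div_le_div_of_nonpos_of_le hlog.le (Real.log_le_log hf h2)
  · rw [h3 c hc]
    exact div_le_div_of_nonpos_of_le hlog.le (Real.log_le_log (by positivity) h1)

/-! ### Lipschitz graphs over the torus -/

section Graph

variable {D : ℕ} {φ : Torus D → I}

theorem measurableEmbedding_graph (hφ : Measurable φ) :
    MeasurableEmbedding fun θ => pt θ (φ θ) := by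
  have : CompactSpace (Torus D) :=
    (PiLp.homeomorph 2 (fun _ : Fin D => UnitAddCircle)).symm.compactSpace
  refine Measurable.measurableEmbedding ?_ fun θ θ' h => congrArg WithLp.fst h
  exact (WithLp.measurable_toLp 2 _).comp (measurable_id.prodMk hφ)

theorem lipschitzOnWith_graph {K : ℝ≥0} {s : Set (Torus D)} (h : LipschitzOnWith K φ s) :
    LipschitzOnWith (1 + K) (fun θ => pt θ (φ θ)) s := by
  refine LipschitzOnWith.of_dist_le_mul fun θ hθ θ' hθ' => (phase_dist_le _ _).trans ?_
  have := h.dist_le_mul θ hθ θ' hθ'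
  push_cast
  rw [add_mul, one_mul]
  exact add_le_add le_rfl this

/-- The lift of Lebesgue measure to a countable union of Lipschitz graphs is rectifiable. As a graph
is projected onto the base by a `1`-Lipschitz map, the lift is absolutely continuous with respect to
Hausdorff measure on the graph, which is `σ`-finite, and the Radon-Nikodym theorem gives the
density. -/
theorem rectifiableMeasure_graph (hφ : Measurable φ) {Ω : ℕ → Set (Torus D)}
    (hΩm : ∀ p, MeasurableSet (Ω p)) (hΩ : ∀ p, ∃ K : ℝ≥0, LipschitzOnWith K φ (Ω p))
    (hfull : lebTorus D (⋃ p, Ω p)ᶜ = 0) :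
    RectifiableMeasure D (Measure.map (fun θ => pt θ (φ θ)) (lebTorus D)) := by
  set G : Torus D → Phase D := fun θ => pt θ (φ θ) with hG
  have hGe : MeasurableEmbedding G := measurableEmbedding_graph hφ
  set μ := Measure.map G (lebTorus D)
  have hprob : IsProbabilityMeasure μ :=
    Measure.isProbabilityMeasure_map hGe.measurable.aemeasurable
  choose K hK using hΩ
  have hGK : ∀ p, LipschitzOnWith (1 + K p) G (Ω p) := fun p => lipschitzOnWith_graph (hK p)
  set A : Set (Phase D) := ⋃ p, G '' Ω p with hA
  have hAm : MeasurableSet A := MeasurableSet.iUnion fun p => hGe.measurableSet_image.2 (hΩm p)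
  set ν : Measure (Phase D) := (Measure.hausdorffMeasure (D : ℝ)).restrict A with hν
  have hσ : SigmaFinite ν := by
    refine ⟨⟨⟨fun p => G '' Ω p ∪ Aᶜ, fun _ => trivial, fun p => ?_, ?_⟩⟩⟩
    · refine (measure_union_le _ _).trans_lt (ENNReal.add_lt_top.2 ⟨?_, ?_⟩)
      · refine (Measure.restrict_apply_le _ _).trans_lt ?_
        refine ((hGK p).hausdorffMeasure_image_le (Nat.cast_nonneg D)).trans_lt ?_
        exact ENNReal.mul_lt_top (by simp)
          ((measure_mono (subset_univ _)).trans_lt hausdorffMeasure_torus_lt_top)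
      · rw [hν, Measure.restrict_apply hAm.compl, compl_inter_self, measure_empty]
        exact ENNReal.zero_lt_top
    · rw [← iUnion_union, union_compl_self]
  have hac : μ ≪ ν := by
    refine Measure.AbsolutelyContinuous.mk fun s hs hs0 => ?_
    rw [hν, Measure.restrict_apply hs] at hs0
    rw [Measure.map_apply hGe.measurable hs]
    have hsub : G ⁻¹' s ⊆ (⋃ p, Ω p)ᶜ ∪ WithLp.fst '' (s ∩ A) := by
      intro θ hθ
      by_cases h : θ ∈ ⋃ p, Ω p
      · obtain ⟨p, hp⟩ := mem_iUnion.1 h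
        exact Or.inr ⟨G θ, ⟨hθ, mem_iUnion.2 ⟨p, mem_image_of_mem _ hp⟩⟩, rfl⟩
      · exact Or.inl h
    refine measure_mono_null hsub (measure_union_null hfull (lebTorus_absolutelyContinuous ?_))
    have hL : LipschitzWith 1 (fun p : Phase D => p.fst) :=
      LipschitzWith.of_dist_le_mul fun p q => by simpa using dist_fst_le p q
    have := hL.hausdorffMeasure_image_le (Nat.cast_nonneg D) (s ∩ A)
    rw [hs0, mul_zero] at this
    exact le_antisymm this zero_le
  refine ⟨inferInstance, A, fun x => (μ.rnDeriv ν x).toNNReal, ⟨hAm, ?_⟩,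
    (Measure.measurable_rnDeriv μ ν).ennreal_toNNReal, ?_⟩
  · obtain ⟨L, hL⟩ := exists_lipschitzWith_torusProj (D := D)
    have hπ : LipschitzWith (L * 1)
        fun x : EuclideanSpace ℝ (Fin D) => torusProj (WithLp.ofLp x) :=
      hL.comp (PiLp.lipschitzWith_ofLp 2 fun _ : Fin D => ℝ)
    refine ⟨fun p => (fun x : EuclideanSpace ℝ (Fin D) => torusProj (WithLp.ofLp x)) ⁻¹' Ω p,
      fun _ x => G (torusProj (WithLp.ofLp x)), fun p => ⟨(1 + K p) * (L * 1), ?_⟩, ?_⟩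
    · exact (hGK p).comp hπ.lipschitzOnWith fun x hx => hx
    · have : A \ ⋃ p, (fun x : EuclideanSpace ℝ (Fin D) => G (torusProj (WithLp.ofLp x))) ''
          ((fun x : EuclideanSpace ℝ (Fin D) => torusProj (WithLp.ofLp x)) ⁻¹' Ω p) = ∅ := by
        rw [sdiff_eq_empty]
        refine iUnion_mono fun p => ?_
        rintro _ ⟨θ, hθ, rfl⟩
        obtain ⟨x, -, rfl⟩ := exists_mem_Icc_torusProj_eq θ
        exact ⟨WithLp.toLp 2 x, hθ, rfl⟩
      rw [this, measure_empty]
  · change μ = ν.withDensity fun x => ((μ.rnDeriv ν x).toNNReal : ℝ≥0∞)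
    conv_lhs => rw [← Measure.withDensity_rnDeriv_eq μ ν hac]
    refine withDensity_congr_ae ?_
    filter_upwards [Measure.rnDeriv_lt_top μ ν] with x hx
    exact (ENNReal.coe_toNNReal hx.ne).symm

theorem measureReal_map_graph_ball_le (hφ : Measurable φ) (θ : Torus D) {ε : ℝ} (hε : 0 < ε) :
    (Measure.map (fun θ => pt θ (φ θ)) (lebTorus D)).real (Metric.ball (pt θ (φ θ)) ε) ≤
      2 ^ D * ε ^ D := by
  rw [← mul_pow, Measure.real,
    Measure.map_apply (measurableEmbedding_graph hφ).measurable Metric.isOpen_ball.measurableSet]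
  have hsub : (fun θ => pt θ (φ θ)) ⁻¹' Metric.ball (pt θ (φ θ)) ε ⊆ Metric.closedBall θ ε :=
    fun θ' hθ' => (dist_fst_le (pt θ' (φ θ')) (pt θ (φ θ))).trans (le_of_lt hθ')
  have := (measure_mono hsub).trans (lebTorus_closedBall_le θ hε.le)
  refine (ENNReal.toReal_mono (ENNReal.pow_ne_top ENNReal.ofReal_ne_top) this).trans (le_of_eq ?_)
  rw [ENNReal.toReal_pow, ENNReal.toReal_ofReal (by positivity)]

/-- At a Lebesgue density point `θ` of a set on which `φ` is Lipschitz, the part of the graph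
over a small ball about `θ` stays in a proportionally small ball about `(θ, φ θ)`. -/
theorem ae_le_measureReal_map_graph_ball (hφ : Measurable φ) {s : Set (Torus D)}
    (hs : MeasurableSet s) {K : ℝ≥0} (hK : LipschitzOnWith K φ s) :
    ∀ᵐ θ ∂lebTorus D, θ ∈ s → ∃ c : ℝ, 0 < c ∧ ∀ᶠ ε : ℝ in 𝓝[>] 0, c * ε ^ D ≤
      (Measure.map (fun θ => pt θ (φ θ)) (lebTorus D)).real (Metric.ball (pt θ (φ θ)) ε) := by
  obtain ⟨κ, hκ, hlow⟩ := exists_le_lebTorus_closedBall (D := D)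
  rw [← ae_restrict_iff' hs]
  filter_upwards [IsUnifLocDoublingMeasure.ae_tendsto_measure_inter_div (lebTorus D) s 1,
    ae_restrict_mem hs] with θ hθ hθs
  set M : ℝ := 2 * (1 + K) with hM
  have hM0 : 0 < M := by positivity
  have hδ : Tendsto (fun ε : ℝ => ε / M) (𝓝[>] 0) (𝓝[>] 0) := by
    refine tendsto_nhdsWithin_iff.2 ⟨?_, ?_⟩
    · have := (continuous_id.div_const M).tendsto (0 : ℝ)
      simp only [id, zero_div] at this
      exact this.mono_left nhdsWithin_le_nhds
    · filter_upwards [self_mem_nhdsWithin] with ε hε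
      exact div_pos hε hM0
  have hmem : ∀ᶠ ε : ℝ in 𝓝[>] 0, θ ∈ Metric.closedBall θ (1 * (ε / M)) := by
    filter_upwards [self_mem_nhdsWithin] with ε hε
    refine Metric.mem_closedBall_self ?_
    rw [one_mul]
    exact (div_pos hε hM0).le
  have hdens := (hθ (fun _ => θ) _ hδ hmem).eventually
    (lt_mem_nhds (show (2 : ℝ≥0∞)⁻¹ < 1 from ENNReal.inv_lt_one.2 ENNReal.one_lt_two))
  refine ⟨2⁻¹ * (κ / M) ^ D, by positivity, ?_⟩
  filter_upwards [hdens, hδ.eventually (Ioo_mem_nhdsGT (show (0 : ℝ) < 1 / 2 by norm_num)),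
    self_mem_nhdsWithin] with ε h1 h2 hε
  have hε' : (0 : ℝ) < ε := hε
  rw [Measure.real,
    Measure.map_apply (measurableEmbedding_graph hφ).measurable Metric.isOpen_ball.measurableSet]
  have hsub : s ∩ Metric.closedBall θ (ε / M) ⊆
      (fun θ => pt θ (φ θ)) ⁻¹' Metric.ball (pt θ (φ θ)) ε := by
    rintro θ' ⟨hθ's, hθ'⟩
    have h3 := (lipschitzOnWith_graph hK).dist_le_mul θ' hθ's θ hθs
    have h4 : dist θ' θ ≤ ε / M := hθ'
    rw [mem_preimage, Metric.mem_ball]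
    refine h3.trans_lt ?_
    calc ((1 + K : ℝ≥0) : ℝ) * dist θ' θ ≤ (1 + K : ℝ≥0) * (ε / M) := by gcongr
      _ = ε / 2 := by rw [hM]; push_cast; field_simp
      _ < ε := half_lt_self hε'
  have h5 : (2 : ℝ≥0∞)⁻¹ * ENNReal.ofReal (κ * (ε / M)) ^ D ≤
      lebTorus D (s ∩ Metric.closedBall θ (ε / M)) := by
    refine (mul_le_mul_right (hlow θ _ h2.1.le h2.2.le) _).trans ?_
    exact ENNReal.mul_le_of_le_div h1.le
  have h6 := ENNReal.toReal_mono (measure_ne_top _ _) (h5.trans (measure_mono hsub))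
  rw [ENNReal.toReal_mul, ENNReal.toReal_pow,
    ENNReal.toReal_ofReal (mul_nonneg hκ.le h2.1.le)] at h6
  refine le_trans (le_of_eq ?_) h6
  rw [ENNReal.toReal_inv, ENNReal.toReal_ofNat, mul_assoc, ← mul_pow]
  congr 2
  ring

theorem ae_tendsto_pointwise_graph (hφ : Measurable φ) {Ω : ℕ → Set (Torus D)}
    (hΩm : ∀ p, MeasurableSet (Ω p)) (hΩ : ∀ p, ∃ K : ℝ≥0, LipschitzOnWith K φ (Ω p))
    (hfull : lebTorus D (⋃ p, Ω p)ᶜ = 0) :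
    ∀ᵐ x ∂(Measure.map (fun θ => pt θ (φ θ)) (lebTorus D)), Tendsto (fun ε : ℝ =>
      Real.log ((Measure.map (fun θ => pt θ (φ θ)) (lebTorus D)).real (Metric.ball x ε)) /
        Real.log ε) (𝓝[>] 0) (𝓝 (D : ℝ)) := by
  rw [(measurableEmbedding_graph hφ).ae_map_iff]
  have hall := ae_all_iff.2 fun p =>
    ae_le_measureReal_map_graph_ball hφ (hΩm p) (hΩ p).choose_spec
  filter_upwards [hall, (mem_ae_iff.2 hfull : (⋃ p, Ω p) ∈ ae (lebTorus D))] with θ h hθ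
  obtain ⟨p, hp⟩ := mem_iUnion.1 hθ
  obtain ⟨c, hc, hlow⟩ := h p hp
  refine tendsto_log_div_log (C := 2 ^ D) hc D hlow ?_
  filter_upwards [self_mem_nhdsWithin] with ε hε
  exact measureReal_map_graph_ball_le hφ θ hε

end Graph

/-! ### Busy times of a queue -/

/-- Each member of `A ⊆ {0, …, N - 1}` is determined by `⌊2 j / g⌋` if distinct members are at
distance at least `g / 2`. -/
theorem card_le_of_separated {A : Finset ℕ} {N g : ℕ} (hg : 0 < g) (hA : ∀ j ∈ A, j < N)
    (hsep : ∀ i ∈ A, ∀ j ∈ A, i < j → g ≤ 2 * (j - i)) : A.card ≤ 2 * N / g + 1 := by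
  have hinj : Set.InjOn (fun j => 2 * j / g) A := by
    have key : ∀ i ∈ A, ∀ j ∈ A, i < j → 2 * i / g ≠ 2 * j / g := by
      intro i hi j hj hij h
      have h1 := hsep i hi j hj hij
      have h2 := Nat.div_add_mod (2 * i) g
      have h3 := Nat.div_add_mod (2 * j) g
      have h4 := Nat.mod_lt (2 * j) hg
      rw [h] at h2
      omega
    intro i hi j hj h
    by_contra hne
    rcases lt_or_gt_of_ne hne with hlt | hlt
    · exact key i hi j hj hlt h
    · exact key j hj i hi hlt h.symm
  have := Finset.card_le_card_of_injOn (t := Finset.range (2 * N / g + 1)) _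
    (fun j hj => by
      simp only [Finset.coe_range, mem_Iio]
      exact Nat.lt_succ_of_le (Nat.div_le_div_right (by have := hA j hj; omega))) hinj
  simpa using this

/-- Total work that arrives up to time `M`, counted by layers: the jobs larger than `s` are
`m 2 ^ s / 2`-separated, and there are none once `m s ≥ p + M`. -/
theorem sum_work_le {m p M : ℕ} (hm : 0 < m) {w : ℕ → ℕ}
    (hdeep : ∀ k s, s < w k → m * s < p + k)
    (hgap : ∀ i j s, i < j → s < w i → s < w j → m * 2 ^ s ≤ 2 * (j - i)) :
    (m : ℝ) * ∑ j ∈ Finset.range M, (w j : ℝ) ≤ 5 * M + p + m := by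
  have hm' : (0 : ℝ) < m := by exact_mod_cast hm
  set S := (p + M) / m + 1 with hS
  have hwS : ∀ j ∈ Finset.range M, w j ≤ S := by
    intro j hj
    by_contra! h
    have h1 := hdeep j S h
    have h2 := Nat.lt_mul_div_succ (p + M) hm
    have h3 := Finset.mem_range.1 hj
    rw [← hS] at h2
    omega
  have hlayer : ∑ j ∈ Finset.range M, w j =
      ∑ s ∈ Finset.range S, ((Finset.range M).filter fun j => s < w j).card := by
    simp only [Finset.card_filter]
    rw [Finset.sum_comm]
    refine Finset.sum_congr rfl fun j hj => ?_
    rw [← Finset.card_filter]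
    have : (Finset.range S).filter (fun s => s < w j) = Finset.range (w j) := by
      ext s
      have := hwS j hj
      simp only [Finset.mem_filter, Finset.mem_range]
      omega
    rw [this, Finset.card_range]
  have hcard : ∀ s, (((Finset.range M).filter fun j => s < w j).card : ℝ) ≤
      2 * M / m * (1 / 2) ^ s + 1 := by
    intro s
    have h1 := card_le_of_separated (A := (Finset.range M).filter fun j => s < w j) (N := M)
      (g := m * 2 ^ s) (by positivity) (fun j hj => by simpa using (Finset.mem_filter.1 hj).1)
      (fun i hi j hj hij => hgap i j s hij (Finset.mem_filter.1 hi).2 (Finset.mem_filter.1 hj).2)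
    have h2 : ((2 * M / (m * 2 ^ s) : ℕ) : ℝ) ≤ (2 * M : ℕ) / (m * 2 ^ s : ℕ) := Nat.cast_div_le
    have h3 : ((2 * M : ℕ) : ℝ) / (m * 2 ^ s : ℕ) = 2 * M / m * (1 / 2) ^ s := by
      push_cast
      rw [one_div, inv_pow]
      field_simp
    have h4 : (((Finset.range M).filter fun j => s < w j).card : ℝ) ≤
        ((2 * M / (m * 2 ^ s) : ℕ) : ℝ) + 1 := by exact_mod_cast h1
    linarith
  have hgeom : ∑ s ∈ Finset.range S, ((1 : ℝ) / 2) ^ s ≤ 2 := by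
    rw [geom_sum_eq (by norm_num)]
    have : (0 : ℝ) < (1 / 2) ^ S := by positivity
    rw [div_le_iff_of_neg (by norm_num)]
    linarith
  have hSle : (S : ℝ) ≤ (p + M) / m + 1 := by
    have : (((p + M) / m : ℕ) : ℝ) ≤ (p + M : ℕ) / m := Nat.cast_div_le
    rw [hS]
    push_cast at this ⊢
    linarith
  calc (m : ℝ) * ∑ j ∈ Finset.range M, (w j : ℝ)
      = m * ∑ s ∈ Finset.range S, (((Finset.range M).filter fun j => s < w j).card : ℝ) := by
        congr 1
        exact_mod_cast hlayer
    _ ≤ m * ∑ s ∈ Finset.range S, (2 * M / m * (1 / 2 : ℝ) ^ s + 1) := by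
        gcongr with s hs
        exact hcard s
    _ = 2 * M * ∑ s ∈ Finset.range S, (1 / 2 : ℝ) ^ s + m * S := by
        rw [Finset.sum_add_distrib, ← Finset.mul_sum]
        simp
        field_simp
    _ ≤ 2 * M * 2 + m * ((p + M) / m + 1) := by gcongr
    _ = _ := by field_simp; ring

/-- The queue `q` runs from time `n` down to time `0`, serves one unit per step and receives the
work `w k` at time `k`. The number of busy times up to `N` is bounded by the work that arrives up to
the last time `M ≥ N` at which the queue is empty; all times between `N` and `M` being busy, `M` is
not much larger than `N`. -/
theorem card_busy_le {m p n N : ℕ} (hm : 5 ≤ m) {w q : ℕ → ℕ} (hqn : q n = 0)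
    (hq : ∀ k < n, q k ≤ q (k + 1) - 1 + w k)
    (hdeep : ∀ k s, s < w k → m * s < p + k)
    (hgap : ∀ i j s, i < j → s < w i → s < w j → m * 2 ^ s ≤ 2 * (j - i)) (hN : N ≤ n) :
    ((m : ℝ) - 5) * ((Finset.range N).filter fun j => q (j + 1) ≠ 0).card ≤
      5 * N + p + m + 5 := by
  set B : ℕ → ℕ := fun M => ((Finset.range M).filter fun j => q (j + 1) ≠ 0).card with hB
  have hBsucc : ∀ M, B (M + 1) = B M + if q (M + 1) ≠ 0 then 1 else 0 := by
    intro M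
    simp only [hB, Finset.range_add_one, Finset.filter_insert]
    split_ifs with h
    · rw [Finset.card_insert_of_notMem (by simp)]
    · rfl
  have hwork : ∀ M ≤ n, q 0 + B M ≤ q M + ∑ j ∈ Finset.range M, w j := by
    intro M
    induction M with
    | zero => intro _; simp [hB]
    | succ M ih =>
      intro hM
      have h1 := ih (by omega)
      have h2 := hq M (by omega)
      rw [hBsucc, Finset.sum_range_succ]
      split_ifs with h <;> omega
  have hex : ∃ M, N ≤ M ∧ q M = 0 := ⟨n, hN, hqn⟩
  obtain ⟨hNM, hqM⟩ := Nat.find_spec hex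
  have hMn : Nat.find hex ≤ n := Nat.find_min' hex ⟨hN, hqn⟩
  have hmin : ∀ j, N ≤ j → j < Nat.find hex → q j ≠ 0 := fun j h1 h2 h3 =>
    Nat.find_min hex h2 ⟨h1, h3⟩
  set M := Nat.find hex
  have hgrow : ∀ i, N + i < M → B N + i ≤ B (N + i) := by
    intro i
    induction i with
    | zero => intro _; simp
    | succ i ih =>
      intro hi
      have h1 := ih (by omega)
      have h2 := hBsucc (N + i)
      rw [if_pos (hmin (N + i + 1) (by omega) (by omega))] at h2
      rw [← add_assoc N i 1, h2]
      omega
  have hNM' : B N + (M - N) ≤ B M + 1 ∧ B N ≤ B M := by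
    refine ⟨?_, Finset.card_le_card (Finset.filter_subset_filter _ ?_)⟩
    swap
    · exact Finset.range_mono hNM
    rcases Nat.lt_or_ge N M with h | h
    · have h1 := hgrow (M - N - 1) (by omega)
      have h2 := hBsucc (N + (M - N - 1))
      rw [show N + (M - N - 1) + 1 = M by omega] at h2
      omega
    · have h1 : M = N := by omega
      rw [h1]; omega
  have h1 := sum_work_le (p := p) (M := M) (by omega : 0 < m) hdeep hgap
  have h2 : ((B M : ℕ) : ℝ) ≤ ∑ j ∈ Finset.range M, (w j : ℝ) := by
    have := hwork M hMn
    rw [hqM] at this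
    exact_mod_cast (by omega : B M ≤ ∑ j ∈ Finset.range M, w j)
  have h3 : (B N : ℝ) + M ≤ B M + 1 + N := by
    exact_mod_cast (by omega : B N + M ≤ B M + 1 + N)
  have h4 : (B N : ℝ) ≤ B M := by exact_mod_cast hNM'.2
  have hm5 : (5 : ℝ) ≤ m := by exact_mod_cast hm
  have h5 : (m : ℝ) * B M ≤ 5 * M + p + m :=
    (mul_le_mul_of_nonneg_left h2 (by linarith)).trans h1
  have h6 : ((m : ℝ) - 5) * B N ≤ (m - 5) * B M :=
    mul_le_mul_of_nonneg_left h4 (by linarith)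
  have h7 : (0 : ℝ) ≤ B N := Nat.cast_nonneg _
  change ((m : ℝ) - 5) * B N ≤ _
  nlinarith

/-- A discrete Grönwall estimate with variable rates. -/
theorem le_sum_prod_of_rec {n : ℕ} {e l : ℕ → ℝ} {δ : ℝ} (hn : e n = 0) (hl : ∀ k, 0 ≤ l k)
    (h : ∀ k < n, e k ≤ l k * e (k + 1) + δ) :
    e 0 ≤ δ * ∑ N ∈ Finset.range n, ∏ j ∈ Finset.range N, l j := by
  have key : ∀ M ≤ n, e 0 ≤ δ * ∑ N ∈ Finset.range M, ∏ j ∈ Finset.range N, l j +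
      (∏ j ∈ Finset.range M, l j) * e M := by
    intro M
    induction M with
    | zero => intro _; simp
    | succ M ih =>
      intro hM
      have h1 := ih (by omega)
      have h2 := mul_le_mul_of_nonneg_left (h M (by omega))
        (Finset.prod_nonneg fun j (_ : j ∈ Finset.range M) => hl j)
      rw [Finset.sum_range_succ, Finset.prod_range_succ]
      linarith
  simpa [hn] using key n le_rfl

/-! ### The iterated upper boundary lines -/

namespace ForcedMap

variable {D : ℕ} (T : ForcedMap D)

/-- The iterated upper boundary line `φ_n(θ) = T^n_{ω^{-n} θ}(1)`. -/
def upperLine : ℕ → Torus D → I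
  | 0, _ => 1
  | n + 1, θ => T.fiber (θ - T.rot) (upperLine n (θ - T.rot))

variable {T}

theorem upperLine_antitone (hT : T.IsClassT) (θ : Torus D) :
    Antitone fun n => T.upperLine n θ := by
  refine antitone_nat_of_succ_le fun n => ?_
  induction n generalizing θ with
  | zero => exact unitInterval.le_one'
  | succ n ih => exact hT.mono _ (ih _)

theorem mem_range_iterate_iff (hT : T.IsClassT) (hc : ∀ θ, Continuous (T.fiber θ)) (n : ℕ)
    (p : Phase D) : p ∈ range (T.map^[n]) ↔ p.snd ≤ T.upperLine n p.fst := by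
  induction n generalizing p with
  | zero => simpa [upperLine] using unitInterval.le_one'
  | succ n ih =>
    rw [Function.iterate_succ', range_comp]
    constructor
    · rintro ⟨z, hz, rfl⟩
      have h := (ih z).1 hz
      have h1 : (T.map z).fst - T.rot = z.fst := add_sub_cancel_right _ _
      have h2 : T.upperLine (n + 1) (T.map z).fst = T.fiber z.fst (T.upperLine n z.fst) := by
        rw [upperLine, h1]
      rw [h2]
      exact hT.mono _ h
    · intro h
      have h0 : T.fiber (p.fst - T.rot) 0 ≤ p.snd := by
        rw [hT.zero]; exact unitInterval.nonneg'
      obtain ⟨y, hy, hy'⟩ := intermediate_value_Icc (unitInterval.nonneg')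
        (hc (p.fst - T.rot)).continuousOn ⟨h0, h⟩
      refine ⟨pt (p.fst - T.rot) y, (ih _).2 hy.2, ?_⟩
      have h1 : T.base (p.fst - T.rot) = p.fst := sub_add_cancel _ _
      change pt (T.base (p.fst - T.rot)) (T.fiber (p.fst - T.rot) y) = p
      rw [h1, hy']
      rfl

theorem upperGraph_eq_iInf (hT : T.IsClassT) (hc : ∀ θ, Continuous (T.fiber θ)) (θ : Torus D) :
    T.upperGraph θ = ⨅ n, T.upperLine n θ := by
  have : {x : I | pt θ x ∈ T.attractor} = Iic (⨅ n, T.upperLine n θ) := by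
    ext x
    rw [mem_Iic, le_iInf_iff]
    exact mem_iInter.trans (forall_congr' fun n => mem_range_iterate_iff hT hc n (pt θ x))
  rw [upperGraph, this, csSup_Iic]

theorem tendsto_upperLine (hT : T.IsClassT) (hc : ∀ θ, Continuous (T.fiber θ)) (θ : Torus D) :
    Tendsto (fun n => T.upperLine n θ) atTop (𝓝 (T.upperGraph θ)) := by
  rw [upperGraph_eq_iInf hT hc]
  exact tendsto_atTop_iInf (upperLine_antitone hT θ)

theorem Estimates.continuous_fiber {θs : Torus D} {α γ L₀ β c d a b : ℝ} {m : ℕ}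
    (h : T.Estimates θs α γ L₀ β c d m a b) (θ : Torus D) : Continuous (T.fiber θ) := by
  have hα : 0 ≤ α := by linarith [h.two_lt_alpha]
  refine (LipschitzWith.of_dist_le_mul (K := ⟨α, hα⟩) fun x y => ?_).continuous
  exact h.lipschitz_fiber θ x y

/-! ### Points whose backward orbit approaches the pinching point slowly -/

/-- The points `θ` for which `ω^{-(k + 1)}(θ)` stays outside the ball of radius
`(b / 2) q ^ (-(p + k))` about `θs`, for every `k ≥ 0`. Time is shifted by one because the value of
a boundary line at `ω^{-k}(θ)` is determined by the fibre map over `ω^{-(k + 1)}(θ)`. It is used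
with `q ^ m = a`. -/
def slowSet (T : ForcedMap D) (θs : Torus D) (b q : ℝ) (p : ℕ) : Set (Torus D) :=
  {θ | ∀ k : ℕ, b / 2 * (q ^ (p + k))⁻¹ ≤ dist (θ - (k + 1) • T.rot) θs}

theorem isClosed_slowSet (θs : Torus D) (b q : ℝ) (p : ℕ) :
    IsClosed (T.slowSet θs b q p) := by
  simp only [slowSet, ofPred_forall]
  refine isClosed_iInter fun k => isClosed_le continuous_const ?_
  exact (continuous_id.sub continuous_const).dist continuous_const

/-- The complement is covered by the balls about `ω^{k + 1} θs`, whose measures have a sum of order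
`q ^ (-p)`. -/
theorem lebTorus_compl_iUnion_slowSet (hD : 1 ≤ D) (θs : Torus D) {b q : ℝ}
    (hb : b ∈ Ioo (0 : ℝ) 1) (hq : 1 < q) : lebTorus D (⋃ p, T.slowSet θs b q p)ᶜ = 0 := by
  set x : ℝ≥0∞ := ENNReal.ofReal q⁻¹ with hx
  have hx1 : x < 1 := by
    rw [hx, ← ENNReal.ofReal_one]
    exact (ENNReal.ofReal_lt_ofReal_iff one_pos).2 (inv_lt_one_of_one_lt₀ hq)
  have hbound : ∀ p, lebTorus D (⋃ p, T.slowSet θs b q p)ᶜ ≤ x ^ p * (1 - x)⁻¹ := by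
    intro p
    have hsub : (⋃ p, T.slowSet θs b q p)ᶜ ⊆
        ⋃ k : ℕ, Metric.closedBall (θs + (k + 1) • T.rot) (b / 2 * (q ^ (p + k))⁻¹) := by
      intro θ hθ
      have h1 : θ ∉ T.slowSet θs b q p := fun h => hθ (mem_iUnion.2 ⟨p, h⟩)
      simp only [slowSet, mem_ofPred_eq, not_forall, not_le] at h1
      obtain ⟨k, hk⟩ := h1
      refine mem_iUnion.2 ⟨k, ?_⟩
      rw [Metric.mem_closedBall]
      have : dist θ (θs + (k + 1) • T.rot) = dist (θ - (k + 1) • T.rot) θs := by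
        rw [dist_eq_norm, dist_eq_norm]
        congr 1
        abel
      rw [this]
      exact hk.le
    refine (measure_mono hsub).trans ((measure_iUnion_le _).trans ?_)
    rw [← ENNReal.tsum_geometric, ← ENNReal.tsum_mul_left]
    refine ENNReal.tsum_le_tsum fun k => ?_
    have hr : (0 : ℝ) < q ^ (p + k) := by positivity
    have hb0 := hb.1
    refine (lebTorus_closedBall_le _ (by positivity)).trans ?_
    rw [← pow_add, hx, ← ENNReal.ofReal_pow (p := q⁻¹) (by positivity), inv_pow]
    have hle : ENNReal.ofReal (2 * (b / 2 * (q ^ (p + k))⁻¹)) ≤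
        ENNReal.ofReal (q ^ (p + k))⁻¹ := by
      refine ENNReal.ofReal_le_ofReal ?_
      rw [← mul_assoc, mul_div_cancel₀ _ two_ne_zero]
      exact mul_le_of_le_one_left (by positivity) hb.2.le
    have hle1 : ENNReal.ofReal (q ^ (p + k))⁻¹ ≤ 1 := by
      rw [ENNReal.ofReal_le_one]
      exact inv_le_one_of_one_le₀ (one_le_pow₀ hq.le)
    calc _ ≤ ENNReal.ofReal (q ^ (p + k))⁻¹ ^ D := by gcongr
      _ ≤ ENNReal.ofReal (q ^ (p + k))⁻¹ ^ 1 := pow_le_pow_right_of_le_one' hle1 hD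
      _ = _ := pow_one _
  have hlim : Tendsto (fun p => x ^ p * (1 - x)⁻¹) atTop (𝓝 (0 * (1 - x)⁻¹)) :=
    ENNReal.Tendsto.mul_const (ENNReal.tendsto_pow_atTop_nhds_zero_of_lt_one hx1)
      (Or.inr (ENNReal.inv_ne_top.2 (tsub_pos_of_lt hx1).ne'))
  rw [zero_mul] at hlim
  exact le_antisymm (ge_of_tendsto' hlim hbound) zero_le

/-! ### Visits to the pinching point -/

theorem iterate_base (θ : Torus D) (n : ℕ) : T.base^[n] θ = θ + n • T.rot := by
  induction n with
  | zero => simp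
  | succ n ih => rw [Function.iterate_succ_apply', ih, base, succ_nsmul, add_assoc]

/-- Two visits of a backward orbit to the ball of radius `(b / 2) a ^ (-s)` about the pinching
point bring the pinching point back to within `b a ^ (-s)` of itself, which takes a long time. -/
theorem Estimates.return_time {θs : Torus D} {α γ L₀ β c d a b : ℝ} {m : ℕ}
    (h : T.Estimates θs α γ L₀ β c d m a b) {θ : Torus D} {i j s : ℕ} (hij : i < j)
    (hi : a ^ s * (2 / b * dist (θ - (i + 1) • T.rot) θs) < 1)
    (hj : a ^ s * (2 / b * dist (θ - (j + 1) • T.rot) θs) < 1) : m * 2 ^ s ≤ 2 * (j - i) := by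
  obtain ⟨n, rfl⟩ : ∃ n, j = i + n := ⟨j - i, by omega⟩
  rw [Nat.add_sub_cancel_left]
  have hn : 1 ≤ n := by omega
  have hb := h.b_mem.1
  have ha : 0 < a := by linarith [h.one_lt_a]
  have has : 0 < a ^ s := by positivity
  have hdist : a ^ s * dist (T.base^[n] θs) θs < b := by
    have h1 : dist (T.base^[n] θs) θs ≤
        dist (θ - (i + n + 1) • T.rot) θs + dist (θ - (i + 1) • T.rot) θs := by
      refine (dist_triangle _ (θ - (i + 1) • T.rot) _).trans (add_le_add (le_of_eq ?_) le_rfl)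
      rw [iterate_base, dist_comm, dist_eq_norm, dist_eq_norm]
      congr 1
      rw [add_assoc i n 1, add_comm n 1, ← add_assoc, add_nsmul T.rot (i + 1) n]
      abel
    have h2 : ∀ x : ℝ, a ^ s * (2 / b * x) = a ^ s * x * 2 / b := fun x => by ring
    rw [h2, div_lt_one hb] at hi hj
    have h3 := mul_le_mul_of_nonneg_left h1 has.le
    linarith
  rcases s with _ | s
  · have : m ≤ n := by
      by_contra! hlt
      have := h.first_iterates n hn hlt
      simp only [pow_zero, one_mul] at hdist
      linarith
    simp
    omega
  · have hn0 : (0 : ℝ) < n := by exact_mod_cast hn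
    have hd : 0 < d := by linarith [h.one_lt_d]
    have h1 : a ^ (s + 1) < (n : ℝ) ^ d := by
      have h2 := mul_le_mul_of_nonneg_left (h.diophantine n hn) has.le
      have h3 : a ^ (s + 1) * (c * (n : ℝ) ^ (-d)) < c := h2.trans_lt (hdist.trans_le h.b_le_c)
      have hnd : 0 < (n : ℝ) ^ d := by positivity
      rw [Real.rpow_neg hn0.le, ← div_eq_mul_inv, mul_div_assoc', div_lt_iff₀ hnd, mul_comm] at h3
      exact lt_of_mul_lt_mul_left h3 h.c_pos.le
    have h2 : (((m : ℝ) + 1) ^ (s + 1)) ^ d ≤ a ^ (s + 1) := by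
      rw [← Real.rpow_natCast_mul (by positivity), mul_comm, Real.rpow_mul_natCast (by positivity)]
      exact pow_le_pow_left₀ (by positivity) h.a_large _
    have h3 : ((m : ℝ) + 1) ^ (s + 1) < n :=
      (Real.rpow_lt_rpow_iff (by positivity) hn0.le hd).1 (h2.trans_lt h1)
    have h4 : (m + 1) ^ (s + 1) < n := by exact_mod_cast h3
    have hm : 1 ≤ m := by
      have h5 := h.m_large
      have h6 := h.gamma_pos
      have : (0 : ℝ) < m := lt_trans (by positivity) h5
      exact_mod_cast this
    have h5 : m * 2 ^ s ≤ (m + 1) ^ (s + 1) := by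
      rw [pow_succ, mul_comm]
      exact Nat.mul_le_mul (Nat.pow_le_pow_left (by omega) s) (by omega)
    rw [pow_succ, ← mul_assoc]
    omega

theorem exists_work {θs : Torus D} {a b q : ℝ} (hb : 0 < b) (ha : 1 < a) (hq : 1 < q) {p : ℕ}
    {θ : Torus D} (hθ : θ ∈ T.slowSet θs b q p) :
    ∃ w : ℕ → ℕ, ∀ k, 1 ≤ a ^ w k * (2 / b * dist (θ - (k + 1) • T.rot) θs) ∧
      ∀ s < w k, a ^ s * (2 / b * dist (θ - (k + 1) • T.rot) θs) < 1 := by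
  refine ⟨fun k => sInf {s | 1 ≤ a ^ s * (2 / b * dist (θ - (k + 1) • T.rot) θs)},
    fun k => ⟨Nat.sInf_mem (s := {s | 1 ≤ a ^ s * (2 / b * dist (θ - (k + 1) • T.rot) θs)}) ?_,
      fun s hs => not_le.1 (Nat.notMem_of_lt_sInf hs)⟩⟩
  have hpos : 0 < dist (θ - (k + 1) • T.rot) θs := lt_of_lt_of_le (by positivity) (hθ k)
  set x := 2 / b * dist (θ - (k + 1) • T.rot) θs with hx
  have hx0 : 0 < x := by positivity
  obtain ⟨s, hs⟩ := pow_unbounded_of_one_lt x⁻¹ ha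
  refine ⟨s, ?_⟩
  change 1 ≤ a ^ s * x
  rw [inv_lt_iff_one_lt_mul₀ hx0] at hs
  linarith

/-- Along a backward orbit of length `n`, the loss `log_a (L₀ / y)` of the boundary line below the
level `L₀` is dominated by a queue which serves one unit per step and receives the work `w k` from
the visit at time `k`. -/
theorem Estimates.exists_queue {θs : Torus D} {α γ L₀ β c d a b : ℝ} {m : ℕ}
    (h : T.Estimates θs α γ L₀ β c d m a b) {θ : Torus D} {w : ℕ → ℕ}
    (hw : ∀ k, 1 ≤ a ^ w k * (2 / b * dist (θ - (k + 1) • T.rot) θs)) (n : ℕ) :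
    ∃ q : ℕ → ℕ, q n = 0 ∧ (∀ k < n, q k ≤ q (k + 1) - 1 + w k) ∧
      ∀ k ≤ n, L₀ ≤ a ^ q k * T.upperLine (n - k) (θ - k • T.rot) := by
  have ha := h.one_lt_a
  have hL := h.L_mem
  let r : ℕ → ℕ := fun j => Nat.rec 0 (fun i x => x - 1 + w (n - (i + 1))) j
  have hr : ∀ j ≤ n, L₀ ≤ a ^ r j * T.upperLine j (θ - (n - j) • T.rot) := by
    intro j
    induction j with
    | zero =>
      intro _
      simpa [r, upperLine] using hL.2.le
    | succ j ih =>
      intro hj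
      have h1 := ih (by omega)
      obtain ⟨i, hi⟩ : ∃ i, n - (j + 1) = i := ⟨_, rfl⟩
      have hi' : n - j = i + 1 := by omega
      rw [hi'] at h1
      have h2 : r (j + 1) = r j - 1 + w i := by rw [← hi]
      rw [hi, h2, upperLine]
      have h3 : θ - i • T.rot - T.rot = θ - (i + 1) • T.rot := by
        rw [succ_nsmul]; abel
      rw [h3]
      set y := T.upperLine j (θ - (i + 1) • T.rot)
      set δ := 2 / b * dist (θ - (i + 1) • T.rot) θs
      have h4 : L₀ ≤ a ^ (r j - 1) * min L₀ (a * y) := by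
        rw [mul_min_of_nonneg _ _ (by positivity), le_min_iff]
        refine ⟨le_mul_of_one_le_left hL.1.le (one_le_pow₀ ha.le), ?_⟩
        rw [← mul_assoc, ← pow_succ]
        refine h1.trans (mul_le_mul_of_nonneg_right (pow_le_pow_right₀ ha.le (by omega)) y.2.1)
      have h5 : 1 ≤ a ^ w i * min 1 δ := by
        rw [mul_min_of_nonneg _ _ (by positivity), le_min_iff, mul_one]
        exact ⟨one_le_pow₀ ha.le, hw i⟩
      have h6 := mul_le_mul h4 h5 zero_le_one (hL.1.le.trans h4)
      have h7 := mul_le_mul_of_nonneg_left (h.reference (θ - (i + 1) • T.rot) y)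
        (by positivity : 0 ≤ a ^ (r j - 1 + w i))
      rw [pow_add] at h7 ⊢
      linarith
  refine ⟨fun k => r (n - k), by simp [r], fun k hk => ?_, fun k hk => ?_⟩
  · obtain ⟨i, hi⟩ : ∃ i, n - (k + 1) = i := ⟨_, rfl⟩
    have hi' : n - k = i + 1 := by omega
    have hik : n - (i + 1) = k := by omega
    simp only [hi', hi]
    exact le_of_eq (by rw [← hik])
  · have := hr (n - k) (by omega)
    rwa [Nat.sub_sub_self hk] at this

/-- On a slow set, the backward orbits are above the level `L₀`, and hence in the region of
contraction, except for a fraction of about `5 / m` of the time. -/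
theorem Estimates.exists_low_times {θs : Torus D} {α γ L₀ β c d a b q : ℝ} {m : ℕ}
    (h : T.Estimates θs α γ L₀ β c d m a b) (hq : 1 < q) (hqm : q ^ m = a) (hm : 5 ≤ m) {p : ℕ}
    {θ : Torus D} (hθ : θ ∈ T.slowSet θs b q p) (n : ℕ) :
    ∃ u : ℕ → ℕ, (∀ k < n, u k = 0 → L₀ ≤ T.upperLine (n - (k + 1)) (θ - (k + 1) • T.rot)) ∧
      ∀ N ≤ n, ((m : ℝ) - 5) * ((Finset.range N).filter fun j => u j ≠ 0).card ≤
        5 * N + p + m + 5 := by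
  have hb := h.b_mem.1
  have ha := h.one_lt_a
  obtain ⟨w, hw⟩ := exists_work hb ha hq hθ
  obtain ⟨Q, hQn, hQ, hQL⟩ := h.exists_queue (fun k => (hw k).1) n
  refine ⟨fun k => Q (k + 1), fun k hk hk0 => ?_, fun N hN => card_busy_le hm hQn hQ ?_ ?_ hN⟩
  · have := hQL (k + 1) hk
    simpa only [hk0, pow_zero, one_mul] using this
  · intro k s hs
    have h1 := (hw k).2 s hs
    have h2 : (q ^ (p + k))⁻¹ ≤ 2 / b * dist (θ - (k + 1) • T.rot) θs := by
      have := mul_le_mul_of_nonneg_left (hθ k) (by positivity : 0 ≤ 2 / b)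
      rwa [← mul_assoc, div_mul_div_cancel₀ hb.ne', div_self two_ne_zero, one_mul] at this
    have h3 : a ^ s * (q ^ (p + k))⁻¹ < 1 :=
      (mul_le_mul_of_nonneg_left h2 (by positivity)).trans_lt h1
    rw [← div_eq_mul_inv, div_lt_one (by positivity), ← hqm, ← pow_mul] at h3
    exact (pow_lt_pow_iff_right₀ hq).1 h3
  · intro i j s hij hi hj
    exact h.return_time hij ((hw i).2 s hi) ((hw j).2 s hj)

/-! ### Lipschitz bounds for the boundary lines -/

/-- On a slow set, the iterated boundary lines are uniformly Lipschitz. Following two backward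
orbits, the distance is multiplied by `α ^ (-γ)` if both are above `L₀` and by at most `α`
otherwise; as the second case has frequency at most about `10 / m`, which is less than
`γ / (1 + γ)`, these factors multiply up to a summable sequence. -/
theorem Estimates.exists_lipschitz_upperLine {θs : Torus D} {α γ L₀ β c d a b q : ℝ} {m : ℕ}
    (h : T.Estimates θs α γ L₀ β c d m a b) (hq : 1 < q) (hqm : q ^ m = a) (p : ℕ) :
    ∃ K : ℝ≥0, ∀ n, LipschitzOnWith K (T.upperLine n) (T.slowSet θs b q p) := by
  have hγ := h.gamma_pos
  have hα : 1 < α := by linarith [h.two_lt_alpha]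
  have hα0 : 0 < α := by linarith
  have hm22 : 22 * (1 + γ) < γ * m := by
    have := h.m_large
    rw [show 22 * (1 + 1 / γ) = 22 * (1 + γ) / γ by field_simp; ring, div_lt_iff₀ hγ] at this
    linarith
  have hm : (22 : ℝ) < m := by nlinarith
  have hm' : 22 < m := by exact_mod_cast hm
  have hm5 : (0 : ℝ) < m - 5 := by linarith
  set η := γ - 10 * (1 + γ) / (m - 5) with hη
  have hη0 : 0 < η := by
    rw [hη, sub_pos, div_lt_iff₀ hm5]
    nlinarith
  set E := 2 * (1 + γ) * (p + m + 5) / (m - 5) with hE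
  have hρ1 : α ^ (-η) < 1 := Real.rpow_lt_one_of_one_lt_of_neg hα (by linarith)
  have hρ0 : 0 ≤ α ^ (-η) := by positivity
  have hK0 : 0 ≤ β * (α ^ E * (1 - α ^ (-η))⁻¹) :=
    mul_nonneg h.beta_pos.le (mul_nonneg (by positivity) (inv_nonneg.2 (by linarith)))
  refine ⟨⟨_, hK0⟩, fun n => LipschitzOnWith.of_dist_le_mul fun θ hθ θ' hθ' => ?_⟩
  obtain ⟨u, hu, hB⟩ := h.exists_low_times hq hqm (by omega) hθ n
  obtain ⟨u', hu', hB'⟩ := h.exists_low_times hq hqm (by omega) hθ' n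
  let l : ℕ → ℝ := fun j =>
    α ^ (-γ + (1 + γ) * ((if u j ≠ 0 then 1 else 0) + (if u' j ≠ 0 then 1 else 0)))
  let e : ℕ → ℝ := fun k =>
    |(T.upperLine (n - k) (θ - k • T.rot) : ℝ) - T.upperLine (n - k) (θ' - k • T.rot)|
  have hrec : ∀ k < n, e k ≤ l k * e (k + 1) + β * dist θ θ' := by
    intro k hk
    obtain ⟨i, hi⟩ : ∃ i, n - (k + 1) = i := ⟨_, rfl⟩
    have hi' : n - k = i + 1 := by omega
    have h3 : ∀ θ : Torus D, θ - k • T.rot - T.rot = θ - (k + 1) • T.rot := fun θ => by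
      rw [succ_nsmul]; abel
    have huk := hu k hk
    have huk' := hu' k hk
    simp only [e, hi, hi', upperLine, h3]
    rw [hi] at huk huk'
    set y := T.upperLine i (θ - (k + 1) • T.rot)
    set y' := T.upperLine i (θ' - (k + 1) • T.rot)
    have hbase : |(T.fiber (θ - (k + 1) • T.rot) y' : ℝ) - T.fiber (θ' - (k + 1) • T.rot) y'| ≤
        β * dist θ θ' := by
      have := h.lipschitz_base (θ - (k + 1) • T.rot) (θ' - (k + 1) • T.rot) y'
      rwa [dist_sub_right] at this
    have hfib : |(T.fiber (θ - (k + 1) • T.rot) y : ℝ) - T.fiber (θ - (k + 1) • T.rot) y'| ≤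
        l k * |(y : ℝ) - y'| := by
      by_cases hgood : u k = 0 ∧ u' k = 0
      · have := h.contraction_fiber (θ - (k + 1) • T.rot) y y' (huk hgood.1) (huk' hgood.2)
        simpa [l, hgood.1, hgood.2] using this
      · refine (h.lipschitz_fiber _ _ _).trans (mul_le_mul_of_nonneg_right ?_ (abs_nonneg _))
        have h1 : (1 : ℝ) ≤ (if u k ≠ 0 then 1 else 0) + (if u' k ≠ 0 then 1 else 0) := by
          split_ifs with h1 h2 h2 <;> norm_num
          exact hgood ⟨not_not.1 h1, not_not.1 h2⟩
        calc α = α ^ (1 : ℝ) := (Real.rpow_one α).symm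
          _ ≤ l k := Real.rpow_le_rpow_of_exponent_le hα.le (by nlinarith)
    exact (abs_sub_le _ _ _).trans (add_le_add hfib hbase)
  have hsum := le_sum_prod_of_rec (e := e) (l := l) (δ := β * dist θ θ') (n := n)
    (by simp [e, upperLine]) (fun k => by positivity) hrec
  have hprod : ∀ N ∈ Finset.range n, ∏ j ∈ Finset.range N, l j ≤ α ^ E * (α ^ (-η)) ^ N := by
    intro N hN
    have hNn := (Finset.mem_range.1 hN).le
    have h1 := hB N hNn
    have h2 := hB' N hNn
    rw [← Real.rpow_sum_of_pos hα0, ← Real.rpow_mul_natCast hα0.le, ← Real.rpow_add hα0]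
    refine Real.rpow_le_rpow_of_exponent_le hα.le ?_
    rw [Finset.sum_add_distrib, ← Finset.mul_sum, Finset.sum_add_distrib, Finset.sum_const,
      Finset.card_range, Finset.sum_boole, Finset.sum_boole, nsmul_eq_mul]
    set B : ℝ := (((Finset.range N).filter fun j => u j ≠ 0).card : ℝ)
    set B' : ℝ := (((Finset.range N).filter fun j => u' j ≠ 0).card : ℝ)
    have h3 : B + B' ≤ 2 * (5 * N + p + m + 5) / (m - 5) := by
      rw [le_div_iff₀ hm5]; linarith
    have h4 := mul_le_mul_of_nonneg_left h3 (by linarith : 0 ≤ 1 + γ)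
    have h5 : (1 + γ) * (2 * (5 * N + p + m + 5) / (m - 5)) = E + (γ - η) * N := by
      rw [hE, hη]; ring
    linarith
  have hgeom : ∑ N ∈ Finset.range n, (α ^ (-η)) ^ N ≤ (1 - α ^ (-η))⁻¹ := by
    rw [← tsum_geometric_of_lt_one hρ0 hρ1]
    exact (summable_geometric_of_lt_one hρ0 hρ1).sum_le_tsum _ fun i _ => by positivity
  have he0 : e 0 = dist (T.upperLine n θ) (T.upperLine n θ') := by
    simp only [e, zero_nsmul, sub_zero, Nat.sub_zero]
    rfl
  rw [← he0]
  have hβd : 0 ≤ β * dist θ θ' := mul_nonneg h.beta_pos.le dist_nonneg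
  calc e 0 ≤ β * dist θ θ' * ∑ N ∈ Finset.range n, α ^ E * (α ^ (-η)) ^ N :=
        hsum.trans (mul_le_mul_of_nonneg_left (Finset.sum_le_sum hprod) hβd)
    _ ≤ β * dist θ θ' * (α ^ E * (1 - α ^ (-η))⁻¹) := by
        rw [← Finset.mul_sum]
        gcongr
    _ = β * (α ^ E * (1 - α ^ (-η))⁻¹) * dist θ θ' := by ring

/-- The upper bounding graph is Lipschitz on each of countably many closed sets whose union has
full measure. -/
theorem IsClassTStar.exists_lipschitzOnWith_upperGraph (hT : T.IsClassTStar) :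
    ∃ Ω : ℕ → Set (Torus D), (∀ p, MeasurableSet (Ω p)) ∧
      (∀ p, ∃ K : ℝ≥0, LipschitzOnWith K T.upperGraph (Ω p)) ∧
      lebTorus D (⋃ p, Ω p)ᶜ = 0 := by
  obtain ⟨hT0, θs, -, α, γ, L₀, β, c, d, m, a, b, h⟩ := hT
  have hD : 1 ≤ D := by
    obtain ⟨i, -⟩ := T.irrational
    exact i.pos
  have hm : m ≠ 0 := by
    rintro rfl
    have h5 := h.m_large
    have h6 := h.gamma_pos
    have : (0 : ℝ) < (0 : ℕ) := lt_trans (by positivity) h5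
    simp at this
  have ha := h.one_lt_a
  have hq : 1 < a ^ ((m : ℝ)⁻¹) := Real.one_lt_rpow ha (by positivity)
  have hqm : (a ^ ((m : ℝ)⁻¹)) ^ m = a := Real.rpow_inv_natCast_pow (by linarith) hm
  refine ⟨T.slowSet θs b (a ^ ((m : ℝ)⁻¹)), fun p => (isClosed_slowSet _ _ _ _).measurableSet,
    fun p => ?_, lebTorus_compl_iUnion_slowSet hD θs h.b_mem hq⟩
  obtain ⟨K, hK⟩ := h.exists_lipschitz_upperLine hq hqm p
  refine ⟨K, LipschitzOnWith.of_dist_le_mul fun θ hθ θ' hθ' => ?_⟩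
  exact le_of_tendsto' ((tendsto_upperLine hT0 h.continuous_fiber θ).dist
    (tendsto_upperLine hT0 h.continuous_fiber θ')) fun n => (hK n).dist_le_mul θ hθ θ' hθ'

end ForcedMap

end PinchedSkew

end

theorem theorem5 (D : ℕ) (T : PinchedSkew.ForcedMap D) (hT : T.IsClassTStar) :
    PinchedSkew.RectifiableMeasure D T.physicalMeasure ∧
      PinchedSkew.IsExactDimensionalWith T.physicalMeasure (D : EReal) ∧
      PinchedSkew.HasInformationDim T.physicalMeasure (D : EReal) := by
  have hφ := hT.measurable_upperGraph
  obtain ⟨Ω, hΩm, hΩ, hfull⟩ := hT.exists_lipschitzOnWith_upperGraph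
  have hlim := PinchedSkew.ae_tendsto_pointwise_graph hφ hΩm hΩ hfull
  have hrect := PinchedSkew.rectifiableMeasure_graph hφ hΩm hΩ hfull
  obtain ⟨C, hC⟩ := PinchedSkew.exists_cover_phase (D := D)
  have : MeasureTheory.IsProbabilityMeasure T.physicalMeasure :=
    MeasureTheory.Measure.isProbabilityMeasure_map
      (PinchedSkew.measurableEmbedding_graph hφ).measurable.aemeasurable
  have hD : ((D : ℝ) : EReal) = (D : EReal) := EReal.coe_natCast
  rw [← hD]
  refine ⟨hrect, ?_, ?_⟩
  · filter_upwards [hlim] with x hx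
    exact PinchedSkew.pointwiseDim_eq_of_tendsto hx
  · refine PinchedSkew.hasInformationDim_of_ae_tendsto (k := D + 1) ?_ hC hlim
    push_cast
    linarith
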